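/- Let $(T,\Sigma,\mu)$ be a complete $\sigma$-finite measure space, let $X$ be a separable real Banach space with dual $X^*$, and let $f:T\times X\to\overline{\mathbb R}$ be a convex normal integrand: $f$ is $\Sigma\otimes\mathcal B(X)$-measurable, and for almost every $t\in T$ the function $f_t:=f(t,\cdot)$ is lower semicontinuous, convex and proper. For $g:T\to\overline{\mathbb R}$ let $\int_T g\,d\mu$ denote the upper integral, i.e. the infimum of $\int_T h\,d\mu$ over all $h\in L^1(T,\mathbb R)$ with $g\le h$ almost everywhere ($+\infty$ if there is no such $h$). Put $I_f(x):=\int_T f(t,x)\,d\mu(t)$ for $x\in X$, $\operatorname{dom} I_f:=\{x\in X: I_f(x)<+\infty\}$, and $\hat I_f(u):=\int_T f(t,u(t))\,d\mu(t)$ for $u\in L^\infty(T,X)$. For $\varepsilon\ge 0$ and $g:X\to\overline{\mathbb R}$ let $$\partial_\varepsilon g(x):=\{x^*\in X^*:\langle x^*,y-x\rangle\le g(y)-g(x)+\varepsilon\ \ \forall y\in X\}$$ if $g(x)$ is finite, and $\partial_\varepsilon g(x):=\emptyset$ otherwise; $N^{\varepsilon}_{A}(x):=\partial_\varepsilon\delta_A(x)$,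 where $\delta_A$ is $0$ on $A$ and $+\infty$ off $A$. For $\eta\ge0$ let $\mathcal I(\eta):=\{\ell\in L^1(T,\mathbb R_+):\int_T\ell\,d\mu\le\eta\}$. Let $L^1_{w^*}(T,X^*)$ be the space of functions $x^*(\cdot):T\to X^*$ such that $t\mapsto\langle x^*(t),v\rangle$ is integrable for every $v\in X$ and $\int_T\sup_{b\in B}\langle x^*(t),b\rangle\,d\mu(t)<+\infty$ (upper integral) for every bounded balanced $B\subseteq X$; for such a function, $\int_T x^*\,d\mu\in X^*$ is the Gelfand integral, $\langle\int_T x^*d\mu,v\rangle=\int_T\langle x^*(t),v\rangle\,d\mu(t)$ for all $v\in X$. Suppose that $\hat I_f$ is bounded above by a real number on some neighbourhood, in $(L^\infty(T,X),\|\cdot\|_\infty)$, of some constant function $x_0(\cdot)\equiv x_0\in X$. Then for every $x\in X$ with $I_f(x)>-\infty$ and every $\varepsilon\ge0$, $$\partial_\varepsilon I_f(x)=\bigcup_{\substack{\varepsilon_1+\varepsilon_2=\varepsilon,\ \varepsilon_1,\varepsilon_2\ge0\\ \ell\in\mathcal I(\varepsilon_1)}}\left(\left\{\int_T x^*\,d\mu:\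 x^*\in L^1_{w^*}(T,X^*),\ x^*(t)\in\partial_{\ell(t)}f_t(x)\text{ for a.e. }t\right\}+N^{\varepsilon_2}_{\operatorname{dom} I_f}(x)\right).$$ If, in addition, $X$ is reflexive, then for all such $x$ and $\varepsilon$ $$\partial_\varepsilon I_f(x)=\bigcup_{\substack{\varepsilon_1+\varepsilon_2=\varepsilon,\ \varepsilon_1,\varepsilon_2\ge0\\ \ell\in\mathcal I(\varepsilon_1)}}\left(\int_T\partial_{\ell(t)}f_t(x)\,d\mu(t)+N^{\varepsilon_2}_{\operatorname{dom} I_f}(x)\right),$$ where $\int_T G(t)\,d\mu(t)$ denotes the set of Bochner integrals $\int_T m\,d\mu$ of the Bochner integrable $m:T\to X^*$ with $m(t)\in G(t)$ for a.e. $t$. -/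

import Mathlib

open MeasureTheory Filter Topology Set
open scoped ENNReal Pointwise

noncomputable section

namespace ConvexIntegral

section ConvexAnalysis

variable {X : Type*} [NormedAddCommGroup X] [NormedSpace ℝ X]

/-- The (effective) domain of an extended real-valued function. -/
def dom (g : X → EReal) : Set X := {x | g x < ⊤}

/-- A function is proper if its domain is nonempty and it never takes the value `-∞`. -/
def IsProper (g : X → EReal) : Prop := (dom g).Nonempty ∧ ∀ x, ⊥ < g x

/-- Convexity of an extended real-valued function: its epigraph in `X × ℝ` is convex. -/
def IsConvex (g : X → EReal) : Prop := Convex ℝ {p : X × ℝ | g p.1 ≤ (p.2 : EReal)}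

/-- The `ε`-subdifferential, empty at the points where `g` is not finite. -/
def epsSubdifferential (ε : ℝ) (g : X → EReal) (x : X) : Set (StrongDual ℝ X) :=
  {ξ | g x ≠ ⊤ ∧ g x ≠ ⊥ ∧ ∀ y, ((ξ (y - x) : ℝ) : EReal) ≤ g y - g x + (ε : EReal)}

open Classical in
/-- The indicator function of convex analysis: `0` on `A` and `+∞` off `A`. -/
def indicatorFun (A : Set X) (x : X) : EReal := if x ∈ A then 0 else ⊤

/-- The `ε`-normal set of `A` at `x`. -/
def epsNormalSet (ε : ℝ) (A : Set X) (x : X) : Set (StrongDual ℝ X) :=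
  epsSubdifferential ε (indicatorFun A) x

/-- The support function of a set `B ⊆ X`, as a function on the dual. -/
def supportFun (B : Set X) (ξ : StrongDual ℝ X) : EReal := ⨆ v ∈ B, ((ξ v : ℝ) : EReal)

/-- Reflexivity: the canonical embedding into the bidual is onto. -/
def IsReflexive (X : Type*) [NormedAddCommGroup X] [NormedSpace ℝ X] : Prop :=
  Function.Surjective (NormedSpace.inclusionInDoubleDual ℝ X)

end ConvexAnalysis

section Integration

variable {T : Type*} [MeasurableSpace T]
variable {X : Type*} [NormedAddCommGroup X] [NormedSpace ℝ X]

/-- The upper integral of an arbitrary extended real-valued function: the infimum of the integrals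
of its integrable majorants, and `+∞` if there are none. -/
def upperIntegral (μ : Measure T) (g : T → EReal) : EReal :=
  ⨅ (h : T → ℝ) (_ : Integrable h μ) (_ : ∀ᵐ t ∂μ, g t ≤ (h t : EReal)),
    ((∫ t, h t ∂μ : ℝ) : EReal)

/-- Convex normal integrands. -/
structure IsConvexNormalIntegrand [MeasurableSpace X] (μ : Measure T) (f : T → X → EReal) :
    Prop where
  measurable : Measurable (fun p : T × X => f p.1 p.2)
  lsc : ∀ᵐ t ∂μ, LowerSemicontinuous (f t)
  convex : ∀ᵐ t ∂μ, IsConvex (f t)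
  proper : ∀ᵐ t ∂μ, IsProper (f t)

/-- The integral function `I_f` on `X`. -/
def integralFun (μ : Measure T) (f : T → X → EReal) (x : X) : EReal :=
  upperIntegral μ (fun t => f t x)

/-- The integral functional `x(·) ↦ ∫ f(t, x(t)) dμ` on `L^∞(T, X)`. -/
def integralFunctional (μ : Measure T) (f : T → X → EReal) (u : Lp X ∞ μ) : EReal :=
  upperIntegral μ (fun t => f t (u t))

/-- The constant function `x₀(·) ≡ x₀` as an element of `L^∞(T, X)`. -/
def constLinfty (μ : Measure T) (x₀ : X) : Lp X ∞ μ :=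
  (memLp_top_const (μ := μ) x₀).toLp (fun _ => x₀)

/-- The functional on `L^∞(T, X)` is bounded above (by a real number) on a neighbourhood of
`u₀` in the norm topology. -/
def BoundedAboveNear {μ : Measure T} (F : Lp X ∞ μ → EReal) (u₀ : Lp X ∞ μ) : Prop :=
  ∃ M : ℝ, ∀ᶠ u in 𝓝 u₀, F u ≤ (M : EReal)

/-- The set `𝓘(η)` of nonnegative integrable functions with integral at most `η`. -/
def integrableBudget (μ : Measure T) (η : ℝ) : Set (T → ℝ) :=
  {ℓ | Integrable ℓ μ ∧ (∀ᵐ t ∂μ, 0 ≤ ℓ t) ∧ ∫ t, ℓ t ∂μ ≤ η}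

/-- `w*`-integrability of a function with values in the dual. -/
def IsWeakStarIntegrable (μ : Measure T) (m : T → StrongDual ℝ X) : Prop :=
  ∀ v : X, Integrable (fun t => m t v) μ

/-- Membership in `L¹_{w*}(T, X*)`: `w*`-integrability, and finite upper integral of
`t ↦ σ_B (m t)` for every bounded balanced `B ⊆ X`. -/
def MemL1WeakStar (μ : Measure T) (m : T → StrongDual ℝ X) : Prop :=
  IsWeakStarIntegrable μ m ∧
    ∀ B : Set X, Bornology.IsBounded B → Balanced ℝ B →
      upperIntegral μ (fun t => supportFun B (m t)) < ⊤

/-- `ξ ∈ X*` is the Gelfand (`w*`-) integral of `m` over `T`. -/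
def IsGelfandIntegral (μ : Measure T) (m : T → StrongDual ℝ X) (ξ : StrongDual ℝ X) : Prop :=
  IsWeakStarIntegrable μ m ∧ ∀ v : X, ξ v = ∫ t, m t v ∂μ

/-- The set of Gelfand integrals of the `L¹_{w*}(T, X*)`-selections of a multifunction. -/
def gelfandAumannIntegral (μ : Measure T) (G : T → Set (StrongDual ℝ X)) :
    Set (StrongDual ℝ X) :=
  {ξ | ∃ m : T → StrongDual ℝ X,
    MemL1WeakStar μ m ∧ (∀ᵐ t ∂μ, m t ∈ G t) ∧ IsGelfandIntegral μ m ξ}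

/-- The strong integral of a multifunction: the set of Bochner integrals of its Bochner integrable
selections. -/
def strongAumannIntegral (μ : Measure T) (G : T → Set (StrongDual ℝ X)) :
    Set (StrongDual ℝ X) :=
  {ξ | ∃ m : T → StrongDual ℝ X,
    Integrable m μ ∧ (∀ᵐ t ∂μ, m t ∈ G t) ∧ ξ = ∫ t, m t ∂μ}

end Integration

end ConvexIntegral

end

/-!
An `ε`-subgradient `ξ` of the integral function `I_f` at `x` splits into the Gelfand integral of
pointwise `ℓ t`-subgradients and an approximate normal to the domain. Only simple functions
`T → X` are used in place of `L^∞(T, X)`, and no measurable selection theorem is needed.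

By Hahn–Banach, `ξ` extends from the constants to a linear functional `L` on simple functions
which is an `ε`-subgradient there (`exists_extension_to_simpleFunc`); boundedness near `x₀` supplies
the interior point, and makes `L` bounded for the uniform norm. As in the Yosida–Hewitt
decomposition, there are sets `F n` increasing to `T`, up to a null set, along which the
restrictions of `L` converge to an absolutely continuous functional (`exists_absCont_part`). By the
Radon–Nikodym theorem, applied along a countable dense subgroup of `X`, this functional is
integration against a weak-star measurable `m : T → X*` dominated in norm by an integrable
function (`IsAbsCont.exists_representation`).

Testing `L` on functions equal to a simple `w` on `F n` and to a constant `z` off `F n`, where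
`x + z` lies in the domain, and letting `n → ∞`, gives the decoupled inequality
(`exists_decoupled_subgradient`)
`∫ (⟨m t, w t⟩ - f t (x + w t) + f t x) + (⟨ξ, z⟩ - ∫ ⟨m t, z⟩) ≤ ε`.
Taking the supremum over `w` with values in a countable dense set yields, by monotone convergence
along running maxima (`exists_integrable_ge_of_forall_simpleFunc`), an integrable `ℓ ≥ 0` which
bounds the integrand at the points of that set and satisfies
`∫ ℓ + (⟨ξ, z⟩ - ∫ ⟨m t, z⟩) ≤ ε` for all such `z`. Almost every `f t` is convex and bounded
above on a ball, so a countable dense set of points suffices to conclude that `m t` is an `ℓ t`-subgradient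
(`IsConvex.affine_le_of_dense`). With `ε₁ = ∫ ℓ` and `ε₂ = ε - ε₁`, the second summand says that
`ξ - ∫ m` is an `ε₂`-normal to the domain. The converse inclusion is obtained by integrating the
pointwise inequalities (`add_mem_epsSubdifferential_integralFun`).

If `X` is reflexive, then `X*` is separable, so `m` is strongly measurable and hence Bochner
integrable.
-/

namespace ConvexIntegral

/-! ### Upper integrals and monotone limits -/

section Tools

variable {T : Type*} [MeasurableSpace T] {μ : Measure T}

lemma upperIntegral_le {g : T → EReal} {h : T → ℝ} (hh : Integrable h μ)
    (hle : ∀ᵐ t ∂μ, g t ≤ (h t : EReal)) : upperIntegral μ g ≤ ((∫ t, h t ∂μ : ℝ) : EReal) :=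
  iInf_le_of_le h (iInf_le_of_le hh (iInf_le_of_le hle le_rfl))

lemma exists_integrable_of_upperIntegral_lt {g : T → EReal} {c : EReal}
    (hc : upperIntegral μ g < c) :
    ∃ h : T → ℝ, Integrable h μ ∧ (∀ᵐ t ∂μ, g t ≤ (h t : EReal)) ∧
      ((∫ t, h t ∂μ : ℝ) : EReal) < c := by
  simpa only [upperIntegral, iInf_lt_iff, exists_prop] using hc

lemma le_upperIntegral {g : T → EReal} {c : EReal}
    (h : ∀ h : T → ℝ, Integrable h μ → (∀ᵐ t ∂μ, g t ≤ (h t : EReal)) →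
      c ≤ ((∫ t, h t ∂μ : ℝ) : EReal)) : c ≤ upperIntegral μ g :=
  le_iInf fun k => le_iInf fun hk => le_iInf fun hle => h k hk hle

lemma upperIntegral_eq_integral {g : T → EReal} {φ : T → ℝ} (hφ : Integrable φ μ)
    (h : ∀ᵐ t ∂μ, g t = (φ t : EReal)) :
    upperIntegral μ g = ((∫ t, φ t ∂μ : ℝ) : EReal) := by
  refine le_antisymm (upperIntegral_le hφ (h.mono fun t ht => ht.le)) (le_upperIntegral ?_)
  intro k hk hle
  rw [EReal.coe_le_coe_iff]
  refine integral_mono_ae hφ hk ?_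
  filter_upwards [h, hle] with t h1 h2
  rw [h1] at h2
  exact_mod_cast h2

lemma upperIntegral_congr_ae {g g' : T → EReal} (h : ∀ᵐ t ∂μ, g t = g' t) :
    upperIntegral μ g = upperIntegral μ g' := by
  refine le_antisymm ?_ ?_
  · refine le_upperIntegral fun k hk hle => upperIntegral_le hk ?_
    filter_upwards [h, hle] with t h1 h2 using h1.trans_le h2
  · refine le_upperIntegral fun k hk hle => upperIntegral_le hk ?_
    filter_upwards [h, hle] with t h1 h2 using h1.symm.trans_le h2

/-- Beppo Levi: an increasing sequence of integrable functions with bounded integrals has an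
integrable upper bound, whose integral is no larger than any bound on theirs. -/
lemma exists_integrable_ge_of_monotone {F : ℕ → T → ℝ} (hF : ∀ n, Integrable (F n) μ)
    (hmono : ∀ᵐ t ∂μ, Monotone fun n => F n t) {K₀ : ℝ} (hK₀ : ∀ n, ∫ t, F n t ∂μ ≤ K₀) :
    ∃ H : T → ℝ, Integrable H μ ∧ (∀ᵐ t ∂μ, ∀ n, F n t ≤ H t) ∧
      ∀ K, (∀ n, ∫ t, F n t ∂μ ≤ K) → ∫ t, H t ∂μ ≤ K := by
  set G : ℕ → T → ℝ≥0∞ := fun n t => ENNReal.ofReal (F n t - F 0 t) with hG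
  have hGm : ∀ n, AEMeasurable (G n) μ := fun n =>
    ((hF n).aemeasurable.sub (hF 0).aemeasurable).ennreal_ofReal
  have hGmono : ∀ᵐ t ∂μ, Monotone fun n => G n t := by
    filter_upwards [hmono] with t ht n m hnm
    exact ENNReal.ofReal_le_ofReal (sub_le_sub_right (ht hnm) _)
  have hint : ∫⁻ t, ⨆ n, G n t ∂μ = ⨆ n, ∫⁻ t, G n t ∂μ := lintegral_iSup' hGm hGmono
  have hGn : ∀ n, ∫⁻ t, G n t ∂μ = ENNReal.ofReal (∫ t, F n t ∂μ - ∫ t, F 0 t ∂μ) := by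
    intro n
    rw [← integral_sub (hF n) (hF 0)]
    refine (ofReal_integral_eq_lintegral_ofReal ((hF n).sub (hF 0)) ?_).symm
    filter_upwards [hmono] with t ht
    simpa using ht (Nat.zero_le n)
  have hbd : ∀ K, (∀ n, ∫ t, F n t ∂μ ≤ K) →
      ∫⁻ t, ⨆ n, G n t ∂μ ≤ ENNReal.ofReal (K - ∫ t, F 0 t ∂μ) := by
    intro K hK
    rw [hint]
    refine iSup_le fun n => ?_
    rw [hGn]
    exact ENNReal.ofReal_le_ofReal (sub_le_sub_right (hK n) _)
  have hm : AEMeasurable (fun t => ⨆ n, G n t) μ := AEMeasurable.iSup hGm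
  have hfin : ∫⁻ t, ⨆ n, G n t ∂μ ≠ ⊤ := ((hbd K₀ hK₀).trans_lt ENNReal.ofReal_lt_top).ne
  have hI : Integrable (fun t => (⨆ n, G n t).toReal) μ :=
    integrable_toReal_of_lintegral_ne_top hm hfin
  refine ⟨fun t => F 0 t + (⨆ n, G n t).toReal, (hF 0).add hI, ?_, ?_⟩
  · filter_upwards [ae_lt_top' hm hfin] with t ht n
    have h1 : G n t ≤ ⨆ n, G n t := le_iSup (fun n => G n t) n
    have h2 := (ENNReal.ofReal_le_iff_le_toReal ht.ne).1 h1
    linarith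
  · intro K hK
    rw [integral_add (hF 0) hI, integral_toReal hm (ae_lt_top' hm hfin)]
    have h1 := ENNReal.toReal_mono ENNReal.ofReal_ne_top (hbd K hK)
    rw [ENNReal.toReal_ofReal (by linarith [hK 0])] at h1
    linarith

/-- A measurable function which is nowhere `-∞` and has a finite upper integral is almost
everywhere equal to an integrable real function. -/
lemma exists_integrable_ae_eq [SigmaFinite μ] {g : T → EReal} (hg : Measurable g)
    (hbot : ∀ᵐ t ∂μ, ⊥ < g t) {H : T → ℝ} (hH : Integrable H μ)
    (hgH : ∀ᵐ t ∂μ, g t ≤ (H t : EReal)) {c : ℝ}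
    (hc : ∀ h : T → ℝ, Integrable h μ → (∀ᵐ t ∂μ, g t ≤ (h t : EReal)) → c ≤ ∫ t, h t ∂μ) :
    ∃ φ : T → ℝ, Measurable φ ∧ Integrable φ μ ∧ ∀ᵐ t ∂μ, g t = (φ t : EReal) := by
  set φ : T → ℝ := fun t => (g t).toReal with hφ
  have hφm : Measurable φ := hg.ereal_toReal
  have hgφ : ∀ᵐ t ∂μ, g t = (φ t : EReal) := by
    filter_upwards [hbot, hgH] with t h1 h2
    exact (EReal.coe_toReal (h2.trans_lt (EReal.coe_lt_top _)).ne h1.ne').symm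
  obtain ⟨w, hw0, hwm, hwfin⟩ := exists_pos_lintegral_lt_of_sigmaFinite μ one_ne_zero
  have hwi : Integrable (fun t => (w t : ℝ)) μ := by
    refine ⟨hwm.coe_nnreal_real.aestronglyMeasurable, ?_⟩
    rw [hasFiniteIntegral_iff_enorm]
    simpa using hwfin.trans ENNReal.one_lt_top
  -- Truncating `H - φ` at `n • w` keeps it integrable; a large truncation would give a majorant
  -- of `g` with too small an integral.
  set D : ℕ → T → ℝ := fun n t => min (H t - φ t) (n * w t) with hD
  have hDnn : ∀ᵐ t ∂μ, 0 ≤ H t - φ t := by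
    filter_upwards [hgφ, hgH] with t h1 h2
    rw [h1] at h2
    exact sub_nonneg.2 (by exact_mod_cast h2)
  have hDm : AEStronglyMeasurable (fun t => H t - φ t) μ :=
    hH.aestronglyMeasurable.sub hφm.aestronglyMeasurable
  have hDi : ∀ n, Integrable (D n) μ := by
    intro n
    refine (hwi.const_mul (n : ℝ)).mono'
      (hDm.inf (hwi.const_mul (n : ℝ)).aestronglyMeasurable) ?_
    filter_upwards [hDnn] with t ht
    rw [Real.norm_of_nonneg (le_min ht (by positivity))]
    exact min_le_right _ _
  obtain ⟨K, hK, hDK, -⟩ := exists_integrable_ge_of_monotone (F := D) (μ := μ) hDi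
    (Eventually.of_forall fun t n m hnm => by
      refine min_le_min_left _ ?_
      have : (n : ℝ) ≤ m := by exact_mod_cast hnm
      exact mul_le_mul_of_nonneg_right this (w t).2)
    (K₀ := ∫ t, H t ∂μ - c) (fun n => by
      have := hc (fun t => H t - D n t) (hH.sub (hDi n)) (by
        filter_upwards [hgφ] with t ht
        rw [ht, EReal.coe_le_coe_iff]
        have : D n t ≤ H t - φ t := min_le_left _ _
        linarith)
      rw [integral_sub hH (hDi n)] at this
      linarith)
  have hDint : Integrable (fun t => H t - φ t) μ := by
    refine hK.mono' hDm ?_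
    filter_upwards [hDnn, hDK] with t h0 h1
    rw [Real.norm_of_nonneg h0]
    obtain ⟨n, hn⟩ := exists_nat_ge ((H t - φ t) / w t)
    have hw : (0 : ℝ) < w t := hw0 t
    rw [div_le_iff₀ hw] at hn
    have h2 := h1 n
    simp only [hD] at h2
    rwa [min_eq_left hn] at h2
  refine ⟨φ, hφm, ?_, hgφ⟩
  refine (hH.sub hDint).congr (Eventually.of_forall fun t => ?_)
  simp

lemma exists_integrable_ae_eq_of_upperIntegral_ne [SigmaFinite μ] {g : T → EReal}
    (hg : Measurable g) (hbot : ∀ᵐ t ∂μ, ⊥ < g t) (h1 : upperIntegral μ g ≠ ⊤)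
    (h2 : upperIntegral μ g ≠ ⊥) :
    ∃ φ : T → ℝ, Measurable φ ∧ Integrable φ μ ∧ ∀ᵐ t ∂μ, g t = (φ t : EReal) := by
  obtain ⟨H, hH, hgH, -⟩ := exists_integrable_of_upperIntegral_lt (lt_top_iff_ne_top.2 h1)
  refine exists_integrable_ae_eq hg hbot hH hgH (c := (upperIntegral μ g).toReal) fun k hk hgk => ?_
  have h3 := upperIntegral_le hk hgk
  rwa [← EReal.coe_toReal h1 h2, EReal.coe_le_coe_iff] at h3

end Tools

/-! ### Running maxima along simple functions -/

section Selection

variable {T : Type*} [MeasurableSpace T] {X : Type*}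

/-- For countably many candidate points, the running maximum of `q t (v 0), …, q t (v n)` is
attained along a simple function, and so involves no measurable selection theorem. -/
lemma exists_simpleFunc_running_max {q : T → X → EReal} (hq : ∀ v, Measurable fun t => q t v)
    (v : ℕ → X) :
    ∃ w : ℕ → SimpleFunc T X, (∀ n t, ∃ i, w n t = v i) ∧
      (∀ t, Monotone fun n => q t (w n t)) ∧ (∀ t, q t (w 0 t) = q t (v 0)) ∧
      ∀ n t, q t (v n) ≤ q t (w n t) := by
  classical
  have hmeas : ∀ w : SimpleFunc T X, Measurable fun t => q t (w t) := fun w =>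
    by
      let _ : MeasurableSpace X := ⊤
      exact w.measurable_bind (fun b a => q a b) hq
  let step : ℕ → SimpleFunc T X → SimpleFunc T X := fun n w =>
    SimpleFunc.piecewise {t | q t (w t) < q t (v (n + 1))}
      (measurableSet_lt (hmeas w) (hq _)) (SimpleFunc.const T (v (n + 1))) w
  let w : ℕ → SimpleFunc T X := fun n => Nat.rec (SimpleFunc.const T (v 0)) step n
  have hsucc : ∀ n t, w (n + 1) t =
      if q t (w n t) < q t (v (n + 1)) then v (n + 1) else w n t := by
    intro n t
    change (SimpleFunc.piecewise _ _ _ _ : SimpleFunc T X) t = _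
    rw [SimpleFunc.piecewise_apply]
    simp only [mem_ofPred_eq]
    congr
  refine ⟨w, ?_, ?_, fun t => rfl, ?_⟩
  · intro n t
    induction n with
    | zero => exact ⟨0, rfl⟩
    | succ n ih =>
      rw [hsucc]
      split_ifs
      · exact ⟨_, rfl⟩
      · exact ih
  · intro t
    refine monotone_nat_of_le_succ fun n => ?_
    rw [hsucc]
    split_ifs with h
    · exact h.le
    · exact le_rfl
  · intro n t
    cases n with
    | zero => exact le_rfl
    | succ n =>
      rw [hsucc]
      split_ifs with h
      · exact le_rfl
      · exact not_lt.1 h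

/-- Interchange of supremum and integral over countably many points: bounds on the integrals of
`t ↦ q t (w t)` for simple `w` give an integrable bound on `t ↦ sup_i q t (v i)` of no larger
integral. -/
lemma exists_integrable_ge_of_forall_simpleFunc {μ : Measure T} {q : T → X → EReal}
    (hq : ∀ v, Measurable fun t => q t v) (v : ℕ → X) {b : T → ℝ} (hb : Integrable b μ)
    (hbq : ∀ᵐ t ∂μ, (b t : EReal) ≤ q t (v 0)) {S : Set ℝ} (hS : S.Nonempty)
    (h : ∀ C ∈ S, ∀ w : SimpleFunc T X, (∀ t, ∃ i, w t = v i) →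
      (∀ t, q t (v 0) ≤ q t (w t)) →
      ∃ k : T → ℝ, Integrable k μ ∧ (∀ᵐ t ∂μ, q t (w t) ≤ (k t : EReal)) ∧ ∫ t, k t ∂μ ≤ C) :
    ∃ H : T → ℝ, Integrable H μ ∧ (∀ᵐ t ∂μ, ∀ i, q t (v i) ≤ (H t : EReal)) ∧
      ∀ C ∈ S, ∫ t, H t ∂μ ≤ C := by
  obtain ⟨w, hwv, hmono, hw0, hwle⟩ := exists_simpleFunc_running_max hq v
  have hmeas : ∀ n, Measurable fun t => q t (w n t) := fun n => by
    let _ : MeasurableSpace X := ⊤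
    exact (w n).measurable_bind (fun b a => q a b) hq
  have hge : ∀ n t, q t (v 0) ≤ q t (w n t) := fun n t =>
    (hw0 t).symm.trans_le (hmono t (Nat.zero_le n))
  set F : ℕ → T → ℝ := fun n t => (q t (w n t)).toReal with hF
  obtain ⟨C₀, hC₀⟩ := hS
  have hFq : ∀ n, ∀ᵐ t ∂μ, q t (w n t) = (F n t : EReal) := by
    intro n
    obtain ⟨k, -, hqk, -⟩ := h C₀ hC₀ (w n) (hwv n) (hge n)
    filter_upwards [hbq, hqk] with t h1 h2
    refine (EReal.coe_toReal (h2.trans_lt (EReal.coe_lt_top _)).ne ?_).symm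
    exact ((EReal.bot_lt_coe _).trans_le (h1.trans (hge n t))).ne'
  have hbound : ∀ n, ∀ k : T → ℝ, (∀ᵐ t ∂μ, q t (w n t) ≤ (k t : EReal)) →
      ∀ᵐ t ∂μ, F n t ≤ k t := by
    intro n k hk
    filter_upwards [hFq n, hk] with t h1 h2
    rw [h1] at h2
    exact_mod_cast h2
  have hFi : ∀ n, Integrable (F n) μ := by
    intro n
    obtain ⟨k, hk, hqk, -⟩ := h C₀ hC₀ (w n) (hwv n) (hge n)
    refine integrable_of_le_of_le (hmeas n).ereal_toReal.aestronglyMeasurable ?_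
      (hbound n k hqk) hb hk
    filter_upwards [hFq n, hbq] with t h1 h2
    have h3 := h2.trans (hge n t)
    rw [h1] at h3
    exact_mod_cast h3
  have hFC : ∀ C ∈ S, ∀ n, ∫ t, F n t ∂μ ≤ C := by
    intro C hC n
    obtain ⟨k, hk, hqk, hkC⟩ := h C hC (w n) (hwv n) (hge n)
    exact (integral_mono_ae (hFi n) hk (hbound n k hqk)).trans hkC
  have hall : ∀ᵐ t ∂μ, ∀ n, q t (w n t) = (F n t : EReal) := ae_all_iff.2 hFq
  obtain ⟨H, hH, hFH, hHK⟩ := exists_integrable_ge_of_monotone (F := F) (μ := μ) hFi (by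
    filter_upwards [hall] with t ht n m hnm
    have := hmono t hnm
    simp only [ht] at this
    exact_mod_cast this) (hFC C₀ hC₀)
  refine ⟨H, hH, ?_, fun C hC => hHK C (hFC C hC)⟩
  filter_upwards [hall, hFH] with t h1 h2 i
  refine (hwle i t).trans ?_
  rw [h1]
  exact_mod_cast h2 i

end Selection

/-! ### Convex functions and extension of linear functionals -/

section Extension

/-- Hahn–Banach in epigraph form: a linear functional `p` on a subspace which lies below a convex
set `C ⊆ E × ℝ` extends to the whole space, provided that the projection of `C` can be reached
from the subspace in every direction. -/
lemma exists_extension_le_of_convex {E : Type*} [AddCommGroup E] [Module ℝ E] {C : Set (E × ℝ)}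
    (hC : Convex ℝ C) (p : E →ₗ.[ℝ] ℝ)
    (hp : ∀ (w : p.domain) (α : ℝ), ((w : E), α) ∈ C → p w ≤ α)
    (hcore : ∀ u : E, ∃ w : p.domain, ∃ s : ℝ, 0 < s ∧ ∃ α : ℝ, ((w : E) + s • u, α) ∈ C) :
    ∃ L : E →ₗ[ℝ] ℝ, (∀ w : p.domain, L w = p w) ∧ ∀ u α, (u, α) ∈ C → L u ≤ α := by
  let K : PointedCone ℝ (E × ℝ) :=
    { carrier := {e | ∃ s : ℝ, 0 ≤ s ∧ ∃ c ∈ C, e = s • c}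
      add_mem' := by
        rintro _ _ ⟨s, hs, c, hc, rfl⟩ ⟨r, hr, d, hd, rfl⟩
        rcases (add_nonneg hs hr).eq_or_lt with h0 | h0
        · have h1 : s = 0 := by linarith
          have h2 : r = 0 := by linarith
          exact ⟨0, le_rfl, c, hc, by simp [h1, h2]⟩
        · refine ⟨s + r, h0.le, _, hC hc hd (div_nonneg hs h0.le) (div_nonneg hr h0.le)
            (by field_simp), ?_⟩
          rw [smul_add, smul_smul, smul_smul, mul_div_cancel₀ _ h0.ne', mul_div_cancel₀ _ h0.ne']
      zero_mem' := by
        obtain ⟨w, s, -, α, h⟩ := hcore 0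
        exact ⟨0, le_rfl, _, h, by simp⟩
      smul_mem' := by
        rintro ⟨r, hr⟩ _ ⟨s, hs, c, hc, rfl⟩
        exact ⟨r * s, mul_nonneg hr hs, c, hc, by rw [mul_smul]; rfl⟩ }
  let D : Submodule ℝ (E × ℝ) := p.domain.prod ⊤
  let F : (E × ℝ) →ₗ.[ℝ] ℝ :=
    { domain := D
      toFun :=
        { toFun := fun e => (e : E × ℝ).2 - p ⟨(e : E × ℝ).1, e.2.1⟩
          map_add' := by
            rintro ⟨⟨a, α⟩, ha⟩ ⟨⟨b, β⟩, hb⟩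
            have := p.map_add ⟨a, ha.1⟩ ⟨b, hb.1⟩
            simp only [AddMemClass.mk_add_mk] at this
            simp only [Submodule.coe_add, Prod.mk_add_mk, this]
            ring
          map_smul' := by
            rintro r ⟨⟨a, α⟩, ha⟩
            have := p.map_smul r ⟨a, ha.1⟩
            simp only [SetLike.mk_smul_mk] at this
            simp only [Submodule.coe_smul, Prod.smul_mk, this, smul_eq_mul, RingHom.id_apply]
            ring } }
  have hF : ∀ (e : F.domain), F e = (e : E × ℝ).2 - p ⟨(e : E × ℝ).1, e.2.1⟩ := fun e => rfl
  obtain ⟨g, hgF, hgK⟩ := riesz_extension K F (by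
    rintro ⟨⟨a, α⟩, ha⟩ ⟨s, hs, ⟨c, γ⟩, hc, hac⟩
    rw [hF]
    simp only [Prod.smul_mk, Prod.mk.injEq, smul_eq_mul] at hac ⊢
    obtain ⟨rfl, rfl⟩ := hac
    rcases hs.eq_or_lt with rfl | hs
    · have : (⟨(0 : ℝ) • c, ha.1⟩ : p.domain) = 0 := by ext; simp
      rw [this, p.map_zero]
      simp
    · have hcd : c ∈ p.domain := by
        have := p.domain.smul_mem s⁻¹ ha.1
        rwa [smul_smul, inv_mul_cancel₀ hs.ne', one_smul] at this
      have h1 := p.map_smul s ⟨c, hcd⟩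
      simp only [SetLike.mk_smul_mk] at h1
      rw [h1, smul_eq_mul, ← mul_sub]
      exact mul_nonneg hs.le (sub_nonneg.2 (hp ⟨c, hcd⟩ γ hc))) (by
    rintro ⟨u, β⟩
    obtain ⟨w, s, hs, α, h⟩ := hcore u
    refine ⟨⟨(s⁻¹ • (w : E), s⁻¹ * α - β), p.domain.smul_mem _ w.2, trivial⟩,
      s⁻¹, (inv_pos.2 hs).le, _, h, ?_⟩
    simp [smul_smul, inv_mul_cancel₀ hs.ne'])
  have hg1 : g ((0 : E), (1 : ℝ)) = 1 := by
    have h1 := hgF ⟨((0 : E), (1 : ℝ)), p.domain.zero_mem, trivial⟩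
    rw [hF] at h1
    have : (⟨(0 : E), p.domain.zero_mem⟩ : p.domain) = 0 := rfl
    rw [h1]
    simp only [this, p.map_zero, sub_zero]
  refine ⟨-(g ∘ₗ LinearMap.inl ℝ E ℝ), ?_, ?_⟩
  · intro w
    have h1 := hgF ⟨((w : E), (0 : ℝ)), w.2, trivial⟩
    rw [hF] at h1
    simpa using congrArg Neg.neg h1
  · intro u α h
    have h1 := hgK (u, α) ⟨1, zero_le_one, _, h, (one_smul _ _).symm⟩
    have h2 : ((u, α) : E × ℝ) = (u, 0) + α • ((0 : E), (1 : ℝ)) := by simp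
    rw [h2, map_add, map_smul, hg1, smul_eq_mul, mul_one] at h1
    simp only [LinearMap.neg_apply, LinearMap.comp_apply, LinearMap.inl_apply]
    linarith

variable {X : Type*} [NormedAddCommGroup X] [NormedSpace ℝ X]

/-- An additive function on a dense subgroup which is bounded by `k ‖·‖` extends to a continuous
real-linear functional. -/
lemma exists_strongDual_of_dense_addSubgroup {D : AddSubgroup X} (hD : Dense (D : Set X))
    {φ : X → ℝ} {k : ℝ} (hk : 0 ≤ k) (hadd : ∀ a ∈ D, ∀ b ∈ D, φ (a + b) = φ a + φ b)
    (hbd : ∀ a ∈ D, |φ a| ≤ k * ‖a‖) :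
    ∃ m : StrongDual ℝ X, (∀ a ∈ D, m a = φ a) ∧ ‖m‖ ≤ k := by
  lift k to NNReal using hk
  have hlip : LipschitzOnWith k φ (D : Set X) := by
    refine LipschitzOnWith.of_dist_le_mul fun a ha b hb => ?_
    have h1 := hadd (a - b) (D.sub_mem ha hb) b hb
    rw [sub_add_cancel] at h1
    have h2 := hbd (a - b) (D.sub_mem ha hb)
    rw [Real.dist_eq, dist_eq_norm, h1, add_sub_cancel_right]
    exact h2
  obtain ⟨ψ, hψ, hφψ⟩ := hlip.extend_real
  have hψadd : ∀ a b, ψ (a + b) = ψ a + ψ b := by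
    have hcl : IsClosed {q : X × X | ψ (q.1 + q.2) = ψ q.1 + ψ q.2} :=
      isClosed_eq (hψ.continuous.comp (continuous_fst.add continuous_snd))
        ((hψ.continuous.comp continuous_fst).add (hψ.continuous.comp continuous_snd))
    have hsub : (D : Set X) ×ˢ (D : Set X) ⊆ {q : X × X | ψ (q.1 + q.2) = ψ q.1 + ψ q.2} := by
      rintro ⟨a, b⟩ ⟨ha, hb⟩
      change ψ (a + b) = ψ a + ψ b
      rw [← hφψ ha, ← hφψ hb, ← hφψ (D.add_mem ha hb)]
      exact hadd a ha b hb
    intro a b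
    exact hcl.closure_subset_iff.2 hsub ((hD.prod hD) (a, b))
  let ψ' : X →+ ℝ := AddMonoidHom.mk' ψ hψadd
  refine ⟨ψ'.toRealLinearMap hψ.continuous, fun a ha => (hφψ ha).symm, ?_⟩
  refine ContinuousLinearMap.opNorm_le_bound _ k.2 fun a => ?_
  have h0 : ψ 0 = 0 := ψ'.map_zero
  have h1 := hψ.dist_le_mul a 0
  rw [h0, dist_zero_right, dist_zero_right] at h1
  exact h1

lemma IsConvex.le_combo {g : X → EReal} (hg : IsConvex g) {p q : X} {α β : ℝ}
    (hp : g p ≤ (α : EReal)) (hq : g q ≤ (β : EReal)) {a b : ℝ} (ha : 0 ≤ a) (hb : 0 ≤ b)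
    (hab : a + b = 1) : g (a • p + b • q) ≤ ((a * α + b * β : ℝ) : EReal) := by
  have h := hg (x := (p, α)) (y := (q, β)) hp hq ha hb hab
  simpa using h

/-- A continuous affine function below a convex function `g` on a dense set is below `g`
everywhere, if `g` is bounded above on some ball. -/
lemma IsConvex.affine_le_of_dense {g : X → EReal} (hg : IsConvex g) {x₀ : X} {r M : ℝ}
    (hr : 0 < r) (hM : ∀ z ∈ Metric.ball x₀ r, g z ≤ (M : EReal)) {D : Set X} (hD : Dense D)
    (m : StrongDual ℝ X) (c : ℝ) (h : ∀ y ∈ D, ((m y + c : ℝ) : EReal) ≤ g y) (y : X) :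
    ((m y + c : ℝ) : EReal) ≤ g y := by
  refine EReal.le_of_forall_lt_iff_le.1 fun β hβ => ?_
  rw [EReal.coe_le_coe_iff]
  set K : ℝ := M - (m x₀ - ‖m‖ * r + c) with hK
  -- The segments from `y` into the ball sweep out open sets arbitrarily close to `y`.
  have key : ∀ s : ℝ, 0 < s → s < 1 → (1 - s) * (m y + c - β) ≤ s * K := by
    intro s hs0 hs1
    have hopen : IsOpen ((fun z : X => s⁻¹ • (z - (1 - s) • y)) ⁻¹' Metric.ball x₀ r) :=
      Metric.isOpen_ball.preimage (by fun_prop)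
    obtain ⟨d, hdU, hdD⟩ := hD.inter_open_nonempty _ hopen ⟨(1 - s) • y + s • x₀, by
      simp [smul_smul, inv_mul_cancel₀ hs0.ne', hr]⟩
    set z : X := s⁻¹ • (d - (1 - s) • y) with hz
    have hzball : z ∈ Metric.ball x₀ r := hdU
    have hd : d = (1 - s) • y + s • z := by
      rw [hz, smul_smul, mul_inv_cancel₀ hs0.ne', one_smul, add_sub_cancel]
    have h1 := (h d hdD).trans
      (hd ▸ hg.le_combo hβ.le (hM z hzball) (sub_nonneg.2 hs1.le) hs0.le (by ring))
    rw [EReal.coe_le_coe_iff, hd, map_add, map_smul, map_smul, smul_eq_mul, smul_eq_mul] at h1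
    have h2 : m x₀ - m z ≤ ‖m‖ * r := by
      rw [← map_sub]
      refine (le_abs_self _).trans ((m.le_opNorm _).trans ?_)
      rw [Metric.mem_ball, dist_comm, dist_eq_norm] at hzball
      exact mul_le_mul_of_nonneg_left hzball.le (norm_nonneg _)
    have h3 : s * (m x₀ - m z) ≤ s * (‖m‖ * r) := mul_le_mul_of_nonneg_left h2 hs0.le
    rw [hK]
    nlinarith
  have hlim : m y + c - β ≤ 0 := by
    have h1 : Tendsto (fun s : ℝ => (1 - s) * (m y + c - β)) (𝓝[>] 0)
        (𝓝 ((1 - 0) * (m y + c - β))) :=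
      ((continuous_const.sub continuous_id).mul continuous_const).continuousAt.tendsto.mono_left
        nhdsWithin_le_nhds
    have h2 : Tendsto (fun s : ℝ => s * K) (𝓝[>] 0) (𝓝 (0 * K)) :=
      (continuous_id.mul continuous_const).continuousAt.tendsto.mono_left nhdsWithin_le_nhds
    have h3 := le_of_tendsto_of_tendsto h1 h2 (by
      filter_upwards [Ioo_mem_nhdsGT (zero_lt_one (α := ℝ))] with s hs using key s hs.1 hs.2)
    simpa using h3
  linarith

end Extension

/-! ### Countably additive parts of functionals on simple functions -/

section Decomposition

variable {T : Type*} [MeasurableSpace T]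

/-- The exhaustion behind the Yosida–Hewitt decomposition: for a nonnegative superadditive set
function `a` and a finite measure `P`, there are sets `F m` increasing to the whole space on whose
subsets `a` is uniformly absolutely continuous with respect to `P`. They almost minimize `a` among
the sets of almost full measure, so that removing a small set from them cannot lower `a` much. -/
lemma exists_exhaustion_absolutelyContinuous (P : Measure T) [IsFiniteMeasure P] (a : Set T → ℝ)
    (h0 : ∀ E, 0 ≤ a E)
    (hadd : ∀ A E, MeasurableSet A → MeasurableSet E → A ⊆ E → a A + a (E \ A) ≤ a E) :
    ∃ F : ℕ → Set T, (∀ m, MeasurableSet (F m)) ∧ Monotone F ∧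
      Tendsto (fun m => P (F m)ᶜ) atTop (𝓝 0) ∧
      ∀ η > (0 : ℝ), ∃ δ > (0 : ℝ≥0∞), ∀ m A, MeasurableSet A → A ⊆ F m → P A ≤ δ → a A ≤ η := by
  have hmono : ∀ A E, MeasurableSet A → MeasurableSet E → A ⊆ E → a A ≤ a E := fun A E hA hE h =>
    (le_add_of_nonneg_right (h0 _)).trans (hadd A E hA hE h)
  let S : ℕ → Set ℝ := fun n => a '' {E | MeasurableSet E ∧ P Eᶜ ≤ 2⁻¹ ^ n}
  have hSne : ∀ n, (S n).Nonempty := fun n => ⟨_, univ, ⟨MeasurableSet.univ, by simp⟩, rfl⟩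
  have hSbdd : ∀ n, BddBelow (S n) := fun n => ⟨0, by rintro _ ⟨E, -, rfl⟩; exact h0 E⟩
  let c : ℕ → ℝ := fun n => sInf (S n)
  have hc : ∀ n E, MeasurableSet E → P Eᶜ ≤ 2⁻¹ ^ n → c n ≤ a E := fun n E hE hP =>
    csInf_le (hSbdd n) ⟨E, ⟨hE, hP⟩, rfl⟩
  have hcbdd : BddAbove (range c) := ⟨a univ, by
    rintro _ ⟨n, rfl⟩
    exact hc n univ MeasurableSet.univ (by simp)⟩
  have hex : ∀ n, ∃ E, MeasurableSet E ∧ P Eᶜ ≤ 2⁻¹ ^ n ∧ a E < c n + (1 / 2) ^ n := by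
    intro n
    obtain ⟨_, ⟨E, ⟨hE, hP⟩, rfl⟩, h⟩ :=
      exists_lt_of_csInf_lt (hSne n)
        (lt_add_of_pos_right (c n) (by positivity : (0 : ℝ) < (1 / 2) ^ n))
    exact ⟨E, hE, hP, h⟩
  choose E hE hPE haE using hex
  set s : ℝ := ⨆ n, c n with hs
  let F : ℕ → Set T := fun m => ⋂ k, E (m + k)
  have hFm : ∀ m, MeasurableSet (F m) := fun m => MeasurableSet.iInter fun k => hE _
  have hFmono : Monotone F := by
    intro m n hmn t ht
    simp only [F, mem_iInter] at ht ⊢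
    intro k
    have := ht (n - m + k)
    rwa [← add_assoc, Nat.add_sub_cancel' hmn] at this
  have hPF : ∀ m, P (F m)ᶜ ≤ 2⁻¹ ^ m * 2 := by
    intro m
    rw [compl_iInter]
    refine (measure_iUnion_le _).trans ((ENNReal.tsum_le_tsum fun k => hPE (m + k)).trans ?_)
    simp_rw [pow_add]
    rw [ENNReal.tsum_mul_left, ENNReal.tsum_geometric, ENNReal.one_sub_inv_two, inv_inv]
  have hlim : Tendsto (fun m : ℕ => (2⁻¹ : ℝ≥0∞) ^ m * 2) atTop (𝓝 0) := by
    have h1 : Tendsto (fun m : ℕ => (2⁻¹ : ℝ≥0∞) ^ m) atTop (𝓝 0) :=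
      ENNReal.tendsto_pow_atTop_nhds_zero_of_lt_one (by norm_num)
    simpa using ENNReal.Tendsto.mul_const h1 (Or.inr (by norm_num : (2 : ℝ≥0∞) ≠ ⊤))
  have haF : ∀ m, a (F m) ≤ s := by
    intro m
    have h1 : ∀ k, a (F m) ≤ s + (1 / 2) ^ (m + k) := fun k =>
      (hmono _ _ (hFm m) (hE _) (iInter_subset _ k)).trans
        ((haE _).le.trans (add_le_add_left (le_ciSup hcbdd _) _))
    have h2 : Tendsto (fun k : ℕ => s + (1 / 2 : ℝ) ^ (m + k)) atTop (𝓝 (s + 0)) := by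
      refine tendsto_const_nhds.add ?_
      have := tendsto_pow_atTop_nhds_zero_of_lt_one (r := (1 / 2 : ℝ)) (by norm_num) (by norm_num)
      have h3 := (tendsto_add_atTop_iff_nat m).2 this
      simpa only [add_comm m] using h3
    simpa using ge_of_tendsto' h2 h1
  refine ⟨F, hFm, hFmono, tendsto_of_tendsto_of_tendsto_of_le_of_le tendsto_const_nhds hlim
    (fun _ => zero_le) hPF, ?_⟩
  intro η hη
  obtain ⟨n, hn⟩ := exists_lt_of_lt_ciSup (sub_lt_self s hη)
  refine ⟨2⁻¹ ^ (n + 1), ENNReal.pow_pos (by norm_num) _, fun m A hA hAF hPA => ?_⟩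
  set m' := max m (n + 2) with hm'
  have hAF' : A ⊆ F m' := hAF.trans (hFmono (le_max_left _ _))
  have h1 : P (F m' \ A)ᶜ ≤ 2⁻¹ ^ n := by
    have h2 : (F m' \ A)ᶜ = (F m')ᶜ ∪ A := by
      rw [Set.sdiff_eq, compl_inter, compl_compl]
    rw [h2]
    refine (measure_union_le _ _).trans ((add_le_add (hPF m') hPA).trans ?_)
    have h3 : (2⁻¹ : ℝ≥0∞) ^ m' ≤ 2⁻¹ ^ (n + 2) :=
      pow_le_pow_right_of_le_one' (by norm_num) (le_max_right _ _)
    have h4 : (2⁻¹ : ℝ≥0∞) * 2 = 1 := ENNReal.inv_mul_cancel (by norm_num) (by norm_num)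
    calc (2⁻¹ : ℝ≥0∞) ^ m' * 2 + 2⁻¹ ^ (n + 1)
        ≤ 2⁻¹ ^ (n + 2) * 2 + 2⁻¹ ^ (n + 1) := by gcongr
      _ = 2⁻¹ ^ (n + 1) + 2⁻¹ ^ (n + 1) := by rw [pow_succ _ (n + 1), mul_assoc, h4, mul_one]
      _ = 2⁻¹ ^ n := by rw [← mul_two, pow_succ, mul_assoc, h4, mul_one]
  have h5 := hc n _ ((hFm m').diff hA) h1
  have h6 := hadd A (F m') hA (hFm m') hAF'
  have h7 := haF m'
  linarith

variable {X : Type*} [NormedAddCommGroup X] [NormedSpace ℝ X]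

/-- Absolute continuity of a functional on simple functions with respect to a measure: it is small
on functions bounded by `1` and supported in a set of small measure. -/
def IsAbsCont (P : Measure T) (L : SimpleFunc T X →ₗ[ℝ] ℝ) : Prop :=
  ∀ η > (0 : ℝ), ∃ δ > (0 : ℝ≥0∞), ∀ A, MeasurableSet A → P A ≤ δ →
    ∀ u : SimpleFunc T X, (∀ t, ‖u t‖ ≤ 1) → (∀ t ∉ A, u t = 0) → |L u| ≤ η

/-- Yosida–Hewitt: along suitable sets `F m` increasing to the whole space, the restrictions of a
bounded functional on simple functions converge to its absolutely continuous part. -/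
lemma exists_absCont_part (P : Measure T) [IsFiniteMeasure P] {L : SimpleFunc T X →ₗ[ℝ] ℝ} {K : ℝ}
    (hK : ∀ u : SimpleFunc T X, (∀ t, ‖u t‖ ≤ 1) → L u ≤ K) :
    ∃ (F : ℕ → Set T) (N : SimpleFunc T X →ₗ[ℝ] ℝ), (∀ m, MeasurableSet (F m)) ∧ Monotone F ∧
      (∀ᵐ t ∂P, ∃ m, t ∈ F m) ∧
      (∀ u, Tendsto (fun m => L (u.restrict (F m))) atTop (𝓝 (N u))) ∧
      (∀ u : SimpleFunc T X, (∀ t, ‖u t‖ ≤ 1) → N u ≤ K) ∧ IsAbsCont P N := by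
  -- the variation of `L`
  let S : Set T → Set ℝ := fun E => L '' {u | (∀ t, ‖u t‖ ≤ 1) ∧ ∀ t ∉ E, u t = 0}
  have hSbdd : ∀ E, BddAbove (S E) := fun E => ⟨K, by rintro _ ⟨u, ⟨hu, -⟩, rfl⟩; exact hK u hu⟩
  have hS0 : ∀ E, (0 : ℝ) ∈ S E := fun E => ⟨0, ⟨by simp, by simp⟩, map_zero L⟩
  let a : Set T → ℝ := fun E => sSup (S E)
  have hle : ∀ E (u : SimpleFunc T X), (∀ t, ‖u t‖ ≤ 1) → (∀ t ∉ E, u t = 0) → L u ≤ a E :=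
    fun E u h1 h2 => le_csSup (hSbdd E) ⟨u, ⟨h1, h2⟩, rfl⟩
  have habs : ∀ E (u : SimpleFunc T X), (∀ t, ‖u t‖ ≤ 1) → (∀ t ∉ E, u t = 0) →
      |L u| ≤ a E := by
    intro E u h1 h2
    refine abs_le'.2 ⟨hle E u h1 h2, ?_⟩
    rw [← map_neg]
    exact hle E (-u) (fun t => by simpa using h1 t) (fun t ht => by simp [h2 t ht])
  obtain ⟨F, hFm, hFmono, hPF, hFac⟩ := exists_exhaustion_absolutelyContinuous P a
    (fun E => le_csSup (hSbdd E) (hS0 E)) (by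
      intro A E hA hE hAE
      refine le_sub_iff_add_le.1 (csSup_le ⟨0, hS0 A⟩ ?_)
      rintro _ ⟨u, ⟨hu1, hu2⟩, rfl⟩
      refine le_sub_comm.1 (csSup_le ⟨0, hS0 _⟩ ?_)
      rintro _ ⟨v, ⟨hv1, hv2⟩, rfl⟩
      refine le_sub_iff_add_le'.2 ?_
      rw [← map_add]
      refine hle E (u + v) (fun t => ?_) (fun t ht => ?_)
      · by_cases ht : t ∈ A
        · simpa [hv2 t fun h => h.2 ht] using hu1 t
        · simpa [hu2 t ht] using hv1 t
      · simp [hu2 t fun h => ht (hAE h), hv2 t fun h => ht h.1])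
  have hFae : ∀ᵐ t ∂P, ∃ m, t ∈ F m := by
    rw [ae_iff]
    refine le_antisymm (ge_of_tendsto' hPF fun m => measure_mono fun t ht => ?_) zero_le
    exact fun h => ht ⟨m, h⟩
  -- a scaled version of the uniform absolute continuity
  have hsmall : ∀ (R : ℝ), 0 < R → ∀ η > (0 : ℝ), ∃ δ > (0 : ℝ≥0∞), ∀ m A, MeasurableSet A →
      A ⊆ F m → P A ≤ δ → ∀ u : SimpleFunc T X, (∀ t, ‖u t‖ ≤ R) → (∀ t ∉ A, u t = 0) →
      |L u| ≤ η := by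
    intro R hR η hη
    obtain ⟨δ, hδ, h⟩ := hFac (η / R) (div_pos hη hR)
    refine ⟨δ, hδ, fun m A hA hAF hPA u hu hu0 => ?_⟩
    have h1 := (habs A (R⁻¹ • u) (fun t => ?_) (fun t ht => ?_)).trans (h m A hA hAF hPA)
    · rw [map_smul, smul_eq_mul, abs_mul, abs_of_pos (inv_pos.2 hR), inv_mul_eq_div,
        div_le_div_iff_of_pos_right hR] at h1
      exact h1
    · rw [SimpleFunc.coe_smul, Pi.smul_apply, norm_smul, norm_inv, Real.norm_of_nonneg hR.le,
        inv_mul_eq_div, div_le_one hR]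
      exact hu t
    · simp [hu0 t ht]
  have hconv : ∀ u : SimpleFunc T X, ∃ l, Tendsto (fun m => L (u.restrict (F m))) atTop (𝓝 l) := by
    intro u
    obtain ⟨R, hR⟩ := u.exists_forall_norm_le
    refine cauchySeq_tendsto_of_complete (Metric.cauchySeq_iff'.2 fun η hη => ?_)
    obtain ⟨δ, hδ, h⟩ := hsmall (|R| + 1) (by positivity) (η / 2) (half_pos hη)
    obtain ⟨m, hm⟩ := (hPF.eventually (ge_mem_nhds hδ)).exists
    refine ⟨m, fun n hn => ?_⟩
    rw [Real.dist_eq, ← map_sub]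
    refine lt_of_le_of_lt (h n (F n \ F m) ((hFm n).diff (hFm m)) sdiff_subset
      ((measure_mono fun t ht => ht.2).trans hm) _ (fun t => ?_) fun t ht => ?_) (half_lt_self hη)
    · rw [SimpleFunc.coe_sub, Pi.sub_apply, SimpleFunc.restrict_apply _ (hFm n),
        SimpleFunc.restrict_apply _ (hFm m)]
      have h1 : ‖u t‖ ≤ |R| + 1 := (hR t).trans ((le_abs_self R).trans (by linarith))
      by_cases h2 : t ∈ F m
      · rw [indicator_of_mem h2, indicator_of_mem (hFmono hn h2), sub_self, norm_zero]
        positivity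
      · rw [indicator_of_notMem h2, sub_zero]
        exact (norm_indicator_le_norm_self _ _).trans h1
    · rw [SimpleFunc.coe_sub, Pi.sub_apply, SimpleFunc.restrict_apply _ (hFm n),
        SimpleFunc.restrict_apply _ (hFm m)]
      by_cases h2 : t ∈ F m
      · rw [indicator_of_mem h2, indicator_of_mem (hFmono hn h2), sub_self]
      · rw [indicator_of_notMem h2, indicator_of_notMem fun h3 => ht ⟨h3, h2⟩, sub_self]
  choose l hl using hconv
  let R : ℕ → SimpleFunc T X →ₗ[ℝ] ℝ := fun m =>
    L ∘ₗ { toFun := fun u => u.restrict (F m)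
           map_add' := fun u v => by
            ext t
            simp only [SimpleFunc.restrict_apply _ (hFm m), SimpleFunc.coe_add, Pi.add_apply]
            exact congrFun (indicator_add (F m) u v) t
           map_smul' := fun r u => by
            ext t
            simp only [SimpleFunc.restrict_apply _ (hFm m), SimpleFunc.coe_smul, Pi.smul_apply]
            exact congrFun (indicator_const_smul (F m) r u) t }
  refine ⟨F, linearMapOfTendsto l R (tendsto_pi_nhds.2 hl), hFm, hFmono, hFae, hl, ?_, ?_⟩
  · intro u hu
    refine le_of_tendsto' (hl u) fun m => hK _ fun t => ?_
    rw [SimpleFunc.restrict_apply _ (hFm m)]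
    exact (norm_indicator_le_norm_self _ _).trans (hu t)
  · intro η hη
    obtain ⟨δ, hδ, h⟩ := hsmall 1 one_pos η hη
    refine ⟨δ, hδ, fun A hA hPA u hu hu0 => ?_⟩
    refine le_of_tendsto' (hl u).abs fun m => ?_
    refine h m (A ∩ F m) (hA.inter (hFm m)) inter_subset_right
      ((measure_mono inter_subset_left).trans hPA) _ (fun t => ?_) fun t ht => ?_
    · rw [SimpleFunc.restrict_apply _ (hFm m)]
      exact (norm_indicator_le_norm_self _ _).trans (hu t)
    · rw [SimpleFunc.restrict_apply _ (hFm m)]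
      by_cases h2 : t ∈ F m
      · rw [indicator_of_mem h2]
        exact hu0 t fun h3 => ht ⟨h3, h2⟩
      · exact indicator_of_notMem h2 _

end Decomposition

/-! ### Integral representation of absolutely continuous functionals -/

section Representation

variable {T : Type*} [MeasurableSpace T]
variable {X : Type*} [NormedAddCommGroup X] [NormedSpace ℝ X]

lemma IsAbsCont.abs_le {P : Measure T} {N : SimpleFunc T X →ₗ[ℝ] ℝ} (hN : IsAbsCont P N)
    {R : ℝ} (hR : 0 < R) {η : ℝ} (hη : 0 < η) :
    ∃ δ > (0 : ℝ≥0∞), ∀ A, MeasurableSet A → P A ≤ δ →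
      ∀ u : SimpleFunc T X, (∀ t, ‖u t‖ ≤ R) → (∀ t ∉ A, u t = 0) → |N u| ≤ η := by
  obtain ⟨δ, hδ, h⟩ := hN (η / R) (div_pos hη hR)
  refine ⟨δ, hδ, fun A hA hPA u hu hu0 => ?_⟩
  have h1 := h A hA hPA (R⁻¹ • u) (fun t => ?_) (fun t ht => ?_)
  · rwa [map_smul, smul_eq_mul, abs_mul, abs_of_pos (inv_pos.2 hR), inv_mul_eq_div,
      div_le_div_iff_of_pos_right hR] at h1
  · rw [SimpleFunc.coe_smul, Pi.smul_apply, norm_smul, norm_inv, Real.norm_of_nonneg hR.le,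
      inv_mul_eq_div, div_le_one hR]
    exact hu t
  · simp [hu0 t ht]

lemma restrict_const_apply {X : Type*} [Zero X] (v : X) {E : Set T} (hE : MeasurableSet E) (t : T) :
    (SimpleFunc.const T v).restrict E t = E.indicator (fun _ => v) t := by
  rw [SimpleFunc.restrict_apply _ hE]
  rfl

/-- Radon–Nikodym along a fixed vector `v`: the set function `E ↦ N (1_E v)` is a signed measure
absolutely continuous with respect to `μ`, and so has a density. -/
lemma IsAbsCont.exists_density {μ P : Measure T} [SigmaFinite μ] [IsFiniteMeasure P] (hPμ : P ≪ μ)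
    {N : SimpleFunc T X →ₗ[ℝ] ℝ} (hN : IsAbsCont P N) (v : X) :
    ∃ g : T → ℝ, Measurable g ∧ Integrable g μ ∧
      ∀ E, MeasurableSet E → N ((SimpleFunc.const T v).restrict E) = ∫ t in E, g t ∂μ := by
  classical
  have hle : ∀ (E : Set T), MeasurableSet E → ∀ t,
      ‖(SimpleFunc.const T v).restrict E t‖ ≤ ‖v‖ + 1 := by
    intro E hE t
    rw [restrict_const_apply v hE]
    exact (norm_indicator_le_norm_self _ _).trans (by linarith)
  have hsupp : ∀ (E : Set T), MeasurableSet E → ∀ t ∉ E,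
      (SimpleFunc.const T v).restrict E t = 0 := by
    intro E hE t ht
    rw [restrict_const_apply v hE, indicator_of_notMem ht]
  have hdiff : ∀ A E : Set T, MeasurableSet A → MeasurableSet E → A ⊆ E →
      N ((SimpleFunc.const T v).restrict E) = N ((SimpleFunc.const T v).restrict A) +
        N ((SimpleFunc.const T v).restrict (E \ A)) := by
    intro A E hA hE hAE
    rw [← map_add]
    congr 1
    ext t
    rw [SimpleFunc.coe_add, Pi.add_apply, restrict_const_apply v hE, restrict_const_apply v hA,
      restrict_const_apply v (hE.diff hA)]
    by_cases h1 : t ∈ A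
    · simp [h1, hAE h1]
    · by_cases h2 : t ∈ E <;> simp [h1, h2]
  let s : SignedMeasure T :=
    { measureOf' := fun E =>
        if MeasurableSet E then N ((SimpleFunc.const T v).restrict E) else 0
      empty' := by
        rw [if_pos MeasurableSet.empty, SimpleFunc.restrict_empty, map_zero]
      not_measurable' := fun E hE => if_neg hE
      m_iUnion' := by
        intro E hE hdisj
        simp only [hE, MeasurableSet.iUnion hE, if_true]
        have hfin : ∀ I : Finset ℕ, MeasurableSet (⋃ i ∈ I, E i) := fun I =>
          I.measurableSet_biUnion fun i _ => hE i
        have hsum : ∀ I : Finset ℕ, ∑ i ∈ I, N ((SimpleFunc.const T v).restrict (E i)) =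
            N ((SimpleFunc.const T v).restrict (⋃ i ∈ I, E i)) := by
          intro I
          induction I using Finset.induction_on with
          | empty => simp
          | insert i I hi ih =>
            rw [Finset.sum_insert hi, ih, hdiff (E i) (⋃ j ∈ insert i I, E j) (hE i) (hfin _)
              (subset_biUnion_of_mem (u := E) (Finset.mem_insert_self i I))]
            congr 3
            ext t
            simp only [Set.mem_sdiff, mem_iUnion, Finset.mem_insert, exists_prop]
            constructor
            · rintro ⟨j, hj, ht⟩
              refine ⟨⟨j, Or.inr hj, ht⟩, fun h => ?_⟩
              exact disjoint_left.1 (hdisj fun h' : i = j => hi (h' ▸ hj)) h ht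
            · rintro ⟨⟨j, rfl | hj, ht⟩, h⟩
              · exact absurd ht h
              · exact ⟨j, hj, ht⟩
        rw [HasSum, SummationFilter.unconditional_filter, Metric.tendsto_nhds]
        intro η hη
        obtain ⟨δ, hδ, h⟩ := hN.abs_le (R := ‖v‖ + 1) (by positivity) (half_pos hη)
        have htail := ENNReal.tendsto_tsum_compl_atTop_zero (f := fun i => P (E i)) (by
          rw [← measure_iUnion hdisj hE]
          exact measure_ne_top _ _)
        filter_upwards [htail.eventually (ge_mem_nhds hδ)] with I hI
        have hU := MeasurableSet.iUnion hE
        have hsub : ⋃ i ∈ I, E i ⊆ ⋃ i, E i := iUnion₂_subset fun i _ => subset_iUnion E i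
        rw [hsum, dist_comm, Real.dist_eq, hdiff _ _ (hfin I) hU hsub, add_sub_cancel_left]
        refine lt_of_le_of_lt (h _ (hU.diff (hfin I)) (le_trans ?_ hI) _
          (hle _ (hU.diff (hfin I))) (hsupp _ (hU.diff (hfin I)))) (half_lt_self hη)
        refine (measure_mono ?_).trans (measure_iUnion_le fun i : {i // i ∉ I} => E i)
        rintro t ⟨h1, h2⟩
        obtain ⟨i, hi⟩ := mem_iUnion.1 h1
        exact mem_iUnion.2 ⟨⟨i, fun hiI => h2 (mem_biUnion hiI hi)⟩, hi⟩ }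
  have hs : ∀ E, MeasurableSet E → s E = N ((SimpleFunc.const T v).restrict E) := fun E hE =>
    if_pos hE
  have hac : s ≪ᵥ μ.toENNRealVectorMeasure := by
    refine VectorMeasure.AbsolutelyContinuous.mk fun E hE h0 => ?_
    rw [Measure.toENNRealVectorMeasure_apply_measurable hE] at h0
    rw [hs E hE, ← abs_eq_zero]
    refine le_antisymm (le_of_forall_pos_le_add fun η hη => ?_) (abs_nonneg _)
    obtain ⟨δ, hδ, h⟩ := hN.abs_le (R := ‖v‖ + 1) (by positivity) hη
    rw [zero_add]
    exact h E hE (by rw [hPμ h0]; exact zero_le) _ (hle E hE) (hsupp E hE)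
  refine ⟨s.rnDeriv μ, SignedMeasure.measurable_rnDeriv s μ, SignedMeasure.integrable_rnDeriv s μ,
    fun E hE => ?_⟩
  rw [← hs E hE, ← withDensityᵥ_apply (SignedMeasure.integrable_rnDeriv s μ) hE,
    SignedMeasure.withDensityᵥ_rnDeriv_eq s μ hac]

end Representation

section Representation

variable {T : Type*} [MeasurableSpace T]
variable {X : Type*} [NormedAddCommGroup X] [NormedSpace ℝ X]

/-- Densities along fixed vectors represent the functional on all simple functions. -/
lemma integral_density_eq {μ : Measure T} {N : SimpleFunc T X →ₗ[ℝ] ℝ} {g : X → T → ℝ}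
    (hgi : ∀ v, Integrable (g v) μ)
    (hg : ∀ v E, MeasurableSet E → N ((SimpleFunc.const T v).restrict E) = ∫ t in E, g v t ∂μ)
    (w : SimpleFunc T X) :
    Integrable (fun t => g (w t) t) μ ∧ N w = ∫ t, g (w t) t ∂μ := by
  classical
  have h0 : ∀ᵐ t ∂μ, g 0 t = 0 := by
    refine (hgi 0).ae_eq_zero_of_forall_setIntegral_eq_zero fun E hE _ => ?_
    rw [← hg 0 E hE]
    convert map_zero N
    ext t
    rw [restrict_const_apply 0 hE]
    simp
  induction w using SimpleFunc.induction with
  | const c hs =>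
    rename_i s
    have h1 : ∀ᵐ t ∂μ, s.indicator (g c) t = g ((SimpleFunc.piecewise s hs (SimpleFunc.const T c)
        (SimpleFunc.const T 0)) t) t := by
      filter_upwards [h0] with t ht
      rw [SimpleFunc.piecewise_apply]
      by_cases hts : t ∈ s <;> simp [hts, ht]
    refine ⟨((hgi c).indicator hs).congr h1, ?_⟩
    rw [← integral_congr_ae h1, integral_indicator hs, ← hg c s hs]
    congr 1
    ext t
    rw [restrict_const_apply c hs, SimpleFunc.piecewise_apply]
    by_cases hts : t ∈ s <;> simp [hts]
  | add hdisj ih ih' =>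
    rename_i f f'
    have h1 : ∀ᵐ t ∂μ, g (f t) t + g (f' t) t = g ((f + f') t) t := by
      filter_upwards [h0] with t ht
      rw [SimpleFunc.coe_add, Pi.add_apply]
      by_cases hf : f t = 0
      · simp [hf, ht]
      · have hf' : f' t = 0 := by
          by_contra h
          exact disjoint_left.1 hdisj (Function.mem_support.2 hf) (Function.mem_support.2 h)
        simp [hf', ht]
    refine ⟨(ih.1.add ih'.1).congr h1, ?_⟩
    rw [← integral_congr_ae h1, integral_add ih.1 ih'.1, map_add, ih.2, ih'.2]

/-- An absolutely continuous functional on simple functions is integration against a weak-star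
measurable function with values in the dual, whose norm has an integrable bound. The densities
along a countable dense subgroup are additive and bounded off a null set, and determine the
value of the function in the dual. -/
lemma IsAbsCont.exists_representation [TopologicalSpace.SeparableSpace X] {μ P : Measure T}
    [SigmaFinite μ] [IsFiniteMeasure P] (hPμ : P ≪ μ) {N : SimpleFunc T X →ₗ[ℝ] ℝ}
    (hN : IsAbsCont P N) {K : ℝ} (hK : ∀ u : SimpleFunc T X, (∀ t, ‖u t‖ ≤ 1) → N u ≤ K) :
    ∃ (m : T → StrongDual ℝ X) (k : T → ℝ), Integrable k μ ∧ (∀ t, ‖m t‖ ≤ k t) ∧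
      (∀ v, Measurable fun t => m t v) ∧ ∀ w : SimpleFunc T X,
        Integrable (fun t => m t (w t)) μ ∧ N w = ∫ t, m t (w t) ∂μ := by
  classical
  choose g hgm hgi hg using hN.exists_density (μ := μ) hPμ
  have hw := integral_density_eq hgi hg
  have hadd : ∀ a b, ∀ᵐ t ∂μ, g (a + b) t = g a t + g b t := by
    intro a b
    refine (hgi (a + b)).ae_eq_of_forall_setIntegral_eq _ _ ((hgi a).add (hgi b)) fun E hE _ => ?_
    change _ = ∫ t in E, g a t + g b t ∂μ
    rw [integral_add (hgi a).integrableOn (hgi b).integrableOn, ← hg _ E hE, ← hg _ E hE,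
      ← hg _ E hE, ← map_add]
    congr 1
    ext t
    simp only [SimpleFunc.coe_add, Pi.add_apply, restrict_const_apply _ hE]
    by_cases ht : t ∈ E <;> simp [ht]
  have hsmul : ∀ (r : ℝ) a, ∀ᵐ t ∂μ, g (r • a) t = r * g a t := by
    intro r a
    refine (hgi (r • a)).ae_eq_of_forall_setIntegral_eq _ _ ((hgi a).const_mul r) fun E hE _ => ?_
    rw [integral_const_mul, ← hg _ E hE, ← hg _ E hE, ← smul_eq_mul, ← map_smul]
    congr 1
    ext t
    simp only [SimpleFunc.coe_smul, Pi.smul_apply, restrict_const_apply _ hE]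
    by_cases ht : t ∈ E <;> simp [ht]
  let Z := Finsupp.linearCombination ℤ (TopologicalSpace.denseSeq X)
  let D : AddSubgroup X := Z.range.toAddSubgroup
  have hD : Dense (D : Set X) := by
    refine (TopologicalSpace.denseRange_denseSeq X).mono ?_
    rintro _ ⟨i, rfl⟩
    exact ⟨Finsupp.single i 1, by simp [Z]⟩
  have hDc : Countable D := (countable_range Z).to_subtype
  obtain ⟨e, he⟩ := exists_surjective_nat D
  -- the norm bound on `D`, from the unit vectors in the directions of `D`
  obtain ⟨H, hH, hgH, -⟩ := exists_integrable_ge_of_forall_simpleFunc (μ := μ)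
    (q := fun t v => ((g v t : ℝ) : EReal)) (fun v => (hgm v).coe_real_ereal)
    (fun i => ‖(e i : X)‖⁻¹ • (e i : X)) (hgi _) (Eventually.of_forall fun t => le_rfl)
    (S := {K}) (singleton_nonempty K) (by
      rintro C rfl w hwv -
      refine ⟨fun t => g (w t) t, (hw w).1, Eventually.of_forall fun t => le_rfl, ?_⟩
      rw [← (hw w).2]
      refine hK w fun t => ?_
      obtain ⟨i, hi⟩ := hwv t
      rw [hi, norm_smul, norm_inv, norm_norm]
      exact inv_mul_le_one)
  set k : T → ℝ := fun t => max (hH.aestronglyMeasurable.mk H t) 0 with hk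
  have hkm : Measurable k :=
    hH.aestronglyMeasurable.stronglyMeasurable_mk.measurable.max measurable_const
  have hki : Integrable k μ := (hH.congr hH.aestronglyMeasurable.ae_eq_mk).pos_part
  have hk0 : ∀ t, 0 ≤ k t := fun t => le_max_right _ _
  have hbd : ∀ d : D, ∀ᵐ t ∂μ, g (d : X) t ≤ k t * ‖(d : X)‖ := by
    intro d
    obtain ⟨i, rfl⟩ := he d
    filter_upwards [hgH, hH.aestronglyMeasurable.ae_eq_mk,
      hsmul ‖(e i : X)‖ (‖(e i : X)‖⁻¹ • (e i : X))] with t h1 h2 h3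
    have h4 : ‖(e i : X)‖ • ‖(e i : X)‖⁻¹ • (e i : X) = e i := by
      by_cases h : (e i : X) = 0
      · simp [h]
      · rw [smul_smul, mul_inv_cancel₀ (norm_ne_zero_iff.2 h), one_smul]
    rw [h4] at h3
    have h5 : g (‖(e i : X)‖⁻¹ • (e i : X)) t ≤ k t :=
      (EReal.coe_le_coe_iff.1 (h1 i)).trans (h2.le.trans (le_max_left _ _))
    rw [h3, mul_comm]
    exact mul_le_mul_of_nonneg_right h5 (norm_nonneg _)
  -- the points where the densities define a bounded additive function on `D`
  let G : Set T := {t | (∀ a b : D, g ((a : X) + b) t = g a t + g b t) ∧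
    ∀ a : D, |g a t| ≤ k t * ‖(a : X)‖}
  have hGm : MeasurableSet G := by
    refine MeasurableSet.inter ?_ ?_
    · have : {t | ∀ a b : D, g ((a : X) + b) t = g a t + g b t} =
          ⋂ (a : D) (b : D), {t | g ((a : X) + b) t = g a t + g b t} := by
        ext; simp
      change MeasurableSet {t | ∀ a b : D, g ((a : X) + b) t = g a t + g b t}
      rw [this]
      exact MeasurableSet.iInter fun a => MeasurableSet.iInter fun b =>
        measurableSet_eq_fun (hgm _) ((hgm _).add (hgm _))
    · have : {t | ∀ a : D, |g a t| ≤ k t * ‖(a : X)‖} =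
          ⋂ (a : D), {t | |g a t| ≤ k t * ‖(a : X)‖} := by
        ext; simp
      change MeasurableSet {t | ∀ a : D, |g a t| ≤ k t * ‖(a : X)‖}
      rw [this]
      exact MeasurableSet.iInter fun a => measurableSet_le (hgm _).abs (hkm.mul_const _)
  have hGae : ∀ᵐ t ∂μ, t ∈ G := by
    have h1 : ∀ᵐ t ∂μ, ∀ a b : D, g ((a : X) + b) t = g a t + g b t :=
      ae_all_iff.2 fun a => ae_all_iff.2 fun b => hadd a b
    filter_upwards [h1, ae_all_iff.2 hbd, ae_all_iff.2 fun a : D => hsmul (-1) a]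
      with t h1 h2 h3
    refine ⟨h1, fun a => abs_le'.2 ⟨h2 a, ?_⟩⟩
    have h4 := h2 (-a)
    have h5 := h3 a
    rw [neg_one_smul, neg_one_mul] at h5
    rwa [AddSubgroup.coe_neg, norm_neg, h5] at h4
  have hex : ∀ t : T, ∃ m : StrongDual ℝ X, (∀ d ∈ D, m d = G.indicator (g d) t) ∧ ‖m‖ ≤ k t := by
    intro t
    by_cases ht : t ∈ G
    · obtain ⟨m, hm, hmk⟩ := exists_strongDual_of_dense_addSubgroup hD (φ := fun v => g v t)
        (hk0 t) (fun a ha b hb => ht.1 ⟨a, ha⟩ ⟨b, hb⟩) (fun a ha => ht.2 ⟨a, ha⟩)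
      exact ⟨m, fun d hd => by rw [hm d hd, indicator_of_mem ht], hmk⟩
    · exact ⟨0, fun d hd => by rw [indicator_of_notMem ht]; rfl, by simpa using hk0 t⟩
  choose m hmD hmk using hex
  have hmm : ∀ v, Measurable fun t => m t v := by
    intro v
    obtain ⟨d, hdD, hdv⟩ := mem_closure_iff_seq_limit.1 (hD v)
    refine measurable_of_tendsto_metrizable (f := fun n t => m t (d n)) (fun n => ?_)
      (tendsto_pi_nhds.2 fun t => ((m t).continuous.tendsto v).comp hdv)
    have : (fun t => m t (d n)) = G.indicator (g (d n)) := funext fun t => hmD t _ (hdD n)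
    rw [this]
    exact (hgm _).indicator hGm
  have hmi : ∀ v, Integrable (fun t => m t v) μ := fun v =>
    (hki.mul_const ‖v‖).mono' (hmm v).aestronglyMeasurable
      (Eventually.of_forall fun t => (m t).le_of_opNorm_le (hmk t) v)
  have hK0 : 0 ≤ K := by simpa using hK 0 (by simp)
  have hNle : ∀ v E, MeasurableSet E → |∫ t in E, g v t ∂μ| ≤ K * ‖v‖ := by
    intro v E hE
    have h1 : ∀ v : X, N ((SimpleFunc.const T v).restrict E) ≤ K * ‖v‖ := by
      intro v
      have h2 := hK ((SimpleFunc.const T (‖v‖⁻¹ • v)).restrict E) (fun t => by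
        rw [restrict_const_apply _ hE]
        refine (norm_indicator_le_norm_self _ _).trans ?_
        rw [norm_smul, norm_inv, norm_norm]
        exact inv_mul_le_one)
      have h3 : (SimpleFunc.const T v).restrict E =
          ‖v‖ • (SimpleFunc.const T (‖v‖⁻¹ • v)).restrict E := by
        ext t
        rw [SimpleFunc.coe_smul, Pi.smul_apply, restrict_const_apply _ hE,
          restrict_const_apply _ hE]
        by_cases ht : t ∈ E
        · rw [indicator_of_mem ht, indicator_of_mem ht]
          by_cases h : v = 0
          · simp [h]
          · rw [smul_smul, mul_inv_cancel₀ (norm_ne_zero_iff.2 h), one_smul]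
        · simp [ht]
      rw [h3, map_smul, smul_eq_mul, mul_comm]
      exact mul_le_mul_of_nonneg_right h2 (norm_nonneg _)
    rw [← hg v E hE]
    refine abs_le'.2 ⟨h1 v, ?_⟩
    have h2 := h1 (-v)
    have h3 : (SimpleFunc.const T (-v)).restrict E = -(SimpleFunc.const T v).restrict E := by
      ext t
      rw [SimpleFunc.coe_neg, Pi.neg_apply, restrict_const_apply _ hE, restrict_const_apply _ hE]
      by_cases ht : t ∈ E <;> simp [ht]
    rwa [h3, map_neg, norm_neg] at h2
  -- Off `D` this follows from the uniform bounds on both sides and the density of `D`.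
  have hmg : ∀ v, ∀ᵐ t ∂μ, g v t = m t v := by
    intro v
    refine (hgi v).ae_eq_of_forall_setIntegral_eq _ _ (hmi v) fun E hE _ => ?_
    rw [← sub_eq_zero, ← abs_eq_zero]
    set C : ℝ := K + ∫ t, k t ∂μ
    have hlim : Tendsto (fun d : X => C * ‖v - d‖) (𝓝[(D : Set X)] v) (𝓝 (C * ‖v - v‖)) :=
      Tendsto.mono_left
        (continuous_const.mul (continuous_const.sub continuous_id).norm).continuousAt
        nhdsWithin_le_nhds
    have hne : (𝓝[(D : Set X)] v).NeBot := mem_closure_iff_nhdsWithin_neBot.1 (hD v)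
    rw [sub_self, norm_zero, mul_zero] at hlim
    refine le_antisymm (ge_of_tendsto hlim ?_) (abs_nonneg _)
    filter_upwards [self_mem_nhdsWithin] with d hd
    have h1 : ∫ t in E, g v t ∂μ = ∫ t in E, g (v - d) t ∂μ + ∫ t in E, g d t ∂μ := by
      rw [← integral_add (hgi _).integrableOn (hgi _).integrableOn]
      refine integral_congr_ae (ae_restrict_of_ae ?_)
      filter_upwards [hadd (v - d) d] with t ht
      rwa [sub_add_cancel] at ht
    have h2 : ∫ t in E, m t v ∂μ = ∫ t in E, m t (v - d) ∂μ + ∫ t in E, m t d ∂μ := by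
      rw [← integral_add (hmi _).integrableOn (hmi _).integrableOn]
      simp
    have h3 : ∫ t in E, g d t ∂μ = ∫ t in E, m t d ∂μ := by
      refine integral_congr_ae (ae_restrict_of_ae ?_)
      filter_upwards [hGae] with t ht
      rw [hmD t d hd, indicator_of_mem ht]
    have h4 : |∫ t in E, m t (v - d) ∂μ| ≤ (∫ t, k t ∂μ) * ‖v - d‖ := by
      rw [← Real.norm_eq_abs]
      refine (norm_integral_le_of_norm_le (hki.mul_const ‖v - d‖).integrableOn
        (Eventually.of_forall fun t => (m t).le_of_opNorm_le (hmk t) _)).trans ?_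
      rw [← integral_mul_const]
      exact setIntegral_le_integral (hki.mul_const _)
        (Eventually.of_forall fun t => mul_nonneg (hk0 t) (norm_nonneg _))
    calc |∫ t in E, g v t ∂μ - ∫ t in E, m t v ∂μ|
        = |∫ t in E, g (v - d) t ∂μ - ∫ t in E, m t (v - d) ∂μ| := by
          rw [h1, h2, h3]; congr 1; ring
      _ ≤ |∫ t in E, g (v - d) t ∂μ| + |∫ t in E, m t (v - d) ∂μ| := abs_sub _ _
      _ ≤ K * ‖v - d‖ + (∫ t, k t ∂μ) * ‖v - d‖ := add_le_add (hNle _ E hE) h4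
      _ = C * ‖v - d‖ := by ring
  refine ⟨m, k, hki, hmk, hmm, fun w => ?_⟩
  have h1 : ∀ᵐ t ∂μ, ∀ v ∈ w.range, g v t = m t v :=
    (Filter.eventually_all_finset w.range).2 fun v _ => hmg v
  have h2 : ∀ᵐ t ∂μ, g (w t) t = m t (w t) := by
    filter_upwards [h1] with t ht using ht _ (w.mem_range_self t)
  exact ⟨(hw w).1.congr h2, (hw w).2.trans (integral_congr_ae h2)⟩

end Representation

/-! ### Subgradients of the integral functional on simple functions -/

section Functional

variable {T : Type*} [MeasurableSpace T] {μ : Measure T}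
variable {X : Type*} [NormedAddCommGroup X] [NormedSpace ℝ X]

lemma coe_le_sub_add_coe_iff {c a e : ℝ} {Y : EReal} :
    (c : EReal) ≤ Y - a + e ↔ ((c + a - e : ℝ) : EReal) ≤ Y := by
  induction Y with
  | bot => simpa using mod_cast EReal.coe_ne_bot (c + a - e)
  | top => simp
  | coe y =>
    norm_cast
    constructor <;> intro h <;> linarith

/-- Boundedness near a constant function, expressed through simple functions and integrable
majorants. -/
lemma BoundedAboveNear.exists_majorants {X : Type*} [NormedAddCommGroup X]
    {f : T → X → EReal} {x₀ : X}
    (h : BoundedAboveNear (integralFunctional μ f) (constLinfty μ x₀)) :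
    ∃ r > (0 : ℝ), ∃ M : ℝ, ∀ u : SimpleFunc T X, (∀ t, ‖u t - x₀‖ ≤ r) →
      ∃ k : T → ℝ, Integrable k μ ∧ (∀ᵐ t ∂μ, f t (u t) ≤ (k t : EReal)) ∧ ∫ t, k t ∂μ ≤ M := by
  obtain ⟨M, hM⟩ := h
  obtain ⟨ρ, hρ, hball⟩ := Metric.eventually_nhds_iff_ball.1 hM
  refine ⟨ρ / 2, half_pos hρ, M + 1, fun u hu => ?_⟩
  have hmem : MemLp (fun t => u t) ∞ μ := u.memLp_top μ
  have h1 : hmem.toLp _ ∈ Metric.ball (constLinfty μ x₀) ρ := by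
    rw [Metric.mem_ball, dist_eq_norm, constLinfty, ← MemLp.toLp_sub, Lp.norm_toLp]
    refine lt_of_le_of_lt (ENNReal.toReal_le_of_le_ofReal (half_pos hρ).le ?_) (half_lt_self hρ)
    rw [eLpNorm_exponent_top]
    exact eLpNormEssSup_le_of_ae_bound (Eventually.of_forall hu)
  have h2 : upperIntegral μ (fun t => f t (u t)) ≤ M := by
    refine le_trans (le_of_eq (upperIntegral_congr_ae ?_)) (hball _ h1)
    filter_upwards [hmem.coeFn_toLp] with t ht
    rw [ht]
  obtain ⟨k, hk, hfk, hkM⟩ := exists_integrable_of_upperIntegral_lt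
    (h2.trans_lt (EReal.coe_lt_coe_iff.2 (lt_add_one M)))
  exact ⟨k, hk, hfk, (EReal.coe_lt_coe_iff.1 hkM).le⟩

lemma IsConvexNormalIntegrand.measurable_simpleFunc [MeasurableSpace X] {f : T → X → EReal}
    (hf : IsConvexNormalIntegrand μ f) (x : X) (w : SimpleFunc T X) :
    Measurable fun t => f t (x + w t) :=
  hf.measurable.comp (measurable_id.prodMk (w.map (fun v => x + v)).measurable)

lemma IsConvexNormalIntegrand.measurable_section [MeasurableSpace X] {f : T → X → EReal}
    (hf : IsConvexNormalIntegrand μ f) (x : X) : Measurable fun t => f t x :=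
  hf.measurable.comp (measurable_id.prodMk measurable_const)

/-- An `ε`-subgradient `ξ` of the integral function at `x` is the restriction to the constants of
an `ε`-subgradient of the integral functional on simple functions; the Hahn–Banach theorem applies
because the functional has majorants near a constant function. -/
lemma exists_extension_to_simpleFunc {f : T → X → EReal} (hconv : ∀ᵐ t ∂μ, IsConvex (f t))
    {x₀ : X} {r M : ℝ} (hr : 0 < r)
    (hM : ∀ u : SimpleFunc T X, (∀ t, ‖u t - x₀‖ ≤ r) →
      ∃ k : T → ℝ, Integrable k μ ∧ (∀ᵐ t ∂μ, f t (u t) ≤ (k t : EReal)) ∧ ∫ t, k t ∂μ ≤ M)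
    {x : X} {φ : T → ℝ} (hφ : Integrable φ μ) (hfφ : ∀ᵐ t ∂μ, f t x = (φ t : EReal)) {ε : ℝ}
    {ξ : StrongDual ℝ X} (hξ : ξ ∈ epsSubdifferential ε (integralFun μ f) x) :
    ∃ L : SimpleFunc T X →ₗ[ℝ] ℝ, (∀ v, L (SimpleFunc.const T v) = ξ v) ∧
      ∀ (u : SimpleFunc T X) (k : T → ℝ), Integrable k μ →
        (∀ᵐ t ∂μ, f t (x + u t) ≤ (k t : EReal)) → L u ≤ ∫ t, k t ∂μ - ∫ t, φ t ∂μ + ε := by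
  -- The constants are kept as a separate factor, which embeds `X` even when `T` is empty.
  let C : Set ((X × SimpleFunc T X) × ℝ) := {c | ∃ k : T → ℝ, Integrable k μ ∧
    (∀ᵐ t ∂μ, f t (x + (c.1.1 + c.1.2 t)) ≤ (k t : EReal)) ∧
    ∫ t, k t ∂μ - ∫ t, φ t ∂μ + ε ≤ c.2}
  have hC : Convex ℝ C := by
    rintro ⟨⟨y, u⟩, α⟩ ⟨k, hk, hfk, hkα⟩ ⟨⟨y', u'⟩, α'⟩ ⟨k', hk', hfk', hkα'⟩ a b ha hb hab
    refine ⟨fun t => a * k t + b * k' t, (hk.const_mul a).add (hk'.const_mul b), ?_, ?_⟩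
    · filter_upwards [hconv, hfk, hfk'] with t h1 h2 h3
      have h4 := h1.le_combo h2 h3 ha hb hab
      convert h4 using 2
      have h5 : x = (a + b) • x := by rw [hab, one_smul]
      simp only [Prod.smul_mk, Prod.mk_add_mk, SimpleFunc.coe_add, SimpleFunc.coe_smul,
        Pi.add_apply, Pi.smul_apply]
      nth_rewrite 1 [h5]
      module
    · rw [integral_add (hk.const_mul a) (hk'.const_mul b), integral_const_mul, integral_const_mul]
      simp only [Prod.smul_mk, Prod.mk_add_mk, smul_eq_mul] at hkα hkα' ⊢
      have h1 := mul_le_mul_of_nonneg_left hkα ha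
      have h2 := mul_le_mul_of_nonneg_left hkα' hb
      have h3 : b = 1 - a := by linarith
      subst h3
      linarith
  let p : (X × SimpleFunc T X) →ₗ.[ℝ] ℝ :=
    { domain := Submodule.prod ⊤ ⊥
      toFun := ξ.toLinearMap ∘ₗ LinearMap.fst ℝ X (SimpleFunc T X) ∘ₗ Submodule.subtype _ }
  have hIx : integralFun μ f x = ((∫ t, φ t ∂μ : ℝ) : EReal) := upperIntegral_eq_integral hφ hfφ
  obtain ⟨Λ, hΛp, hΛC⟩ := exists_extension_le_of_convex hC p (by
    rintro ⟨⟨y, u⟩, hy, hu⟩ α ⟨k, hk, hfk, hkα⟩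
    have hu0 : u = 0 := hu
    have h1 := hξ.2.2 (x + y)
    rw [hIx, coe_le_sub_add_coe_iff, add_sub_cancel_left] at h1
    have h2 : integralFun μ f (x + y) ≤ ((∫ t, k t ∂μ : ℝ) : EReal) :=
      upperIntegral_le hk (by simpa [hu0] using hfk)
    have h3 := EReal.coe_le_coe_iff.1 (h1.trans h2)
    change ξ y ≤ α
    simp only at hkα
    linarith) (by
    rintro ⟨y, u⟩
    obtain ⟨R, hR⟩ := u.exists_forall_norm_le
    set B : ℝ := ‖y‖ + |R| + 1 with hB
    have hBpos : 0 < B := by positivity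
    have hs : 0 < r / B := div_pos hr hBpos
    obtain ⟨k, hk, hfk, hkM⟩ := hM (SimpleFunc.const T x₀ + (r / B) • (SimpleFunc.const T y + u))
      (fun t => by
        simp only [SimpleFunc.coe_add, SimpleFunc.coe_smul, SimpleFunc.coe_const, Pi.add_apply,
          Pi.smul_apply, Function.const_apply, add_sub_cancel_left]
        rw [norm_smul, Real.norm_of_nonneg hs.le, div_mul_eq_mul_div, div_le_iff₀ hBpos]
        refine mul_le_mul_of_nonneg_left ((norm_add_le _ _).trans ?_) hr.le
        have := (hR t).trans (le_abs_self R)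
        linarith)
    refine ⟨⟨(x₀ - x, 0), trivial, rfl⟩, r / B, hs, _, k, hk, ?_, le_rfl⟩
    filter_upwards [hfk] with t ht
    convert ht using 2
    simp only [SimpleFunc.coe_add, SimpleFunc.coe_smul, SimpleFunc.coe_const, Pi.add_apply,
      Pi.smul_apply, Function.const_apply, Prod.smul_mk, Prod.mk_add_mk, SimpleFunc.coe_zero,
      Pi.zero_apply]
    module)
  have hΛX : ∀ y, Λ (y, 0) = ξ y := fun y => hΛp ⟨(y, 0), trivial, rfl⟩
  have hΛsplit : ∀ y u, Λ (y, u) = ξ y + Λ (0, u) := by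
    intro y u
    rw [← hΛX, ← map_add]
    simp
  refine ⟨Λ ∘ₗ LinearMap.inr ℝ X (SimpleFunc T X), ?_, ?_⟩
  · intro v
    -- `(s • v, - s • v)` does not move the argument of `f`, so `Λ` is bounded along that line
    have h1 : ∀ s : ℝ, s * (ξ v - Λ (0, SimpleFunc.const T v)) ≤ ε := by
      intro s
      have h2 := hΛC (s • (v, -SimpleFunc.const T v)) ε ⟨φ, hφ, by
        filter_upwards [hfφ] with t ht
        simp [ht], by simp⟩
      rw [map_smul, hΛsplit] at h2
      have h3 : Λ (0, -SimpleFunc.const T v) = -Λ (0, SimpleFunc.const T v) := by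
        rw [← map_neg]; simp
      rwa [h3, smul_eq_mul, ← sub_eq_add_neg] at h2
    have h4 : ξ v - Λ (0, SimpleFunc.const T v) = 0 := by
      by_contra h
      have h5 := h1 ((ε + 1) / (ξ v - Λ (0, SimpleFunc.const T v)))
      rw [div_mul_cancel₀ _ h] at h5
      linarith
    exact (sub_eq_zero.1 h4).symm
  · intro u k hk hfk
    exact hΛC (0, u) _ ⟨k, hk, by simpa using hfk, le_rfl⟩

end Functional

section Functional

variable {T : Type*} [MeasurableSpace T] {μ : Measure T} [SigmaFinite μ]
variable {X : Type*} [NormedAddCommGroup X] [NormedSpace ℝ X]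

/-- The decoupled subgradient inequality: the absolutely continuous part `m` of the extension of
`ξ` to simple functions is tested against an arbitrary simple function `w`, and independently the
singular remainder against an arbitrary point `x + z` of the domain of the integral function. This
is the subgradient inequality for functions equal to `w` on a large set and to `z` elsewhere. -/
lemma exists_decoupled_subgradient [TopologicalSpace.SeparableSpace X]
    {f : T → X → EReal} (hconv : ∀ᵐ t ∂μ, IsConvex (f t)) {x₀ : X} {r M : ℝ} (hr : 0 < r)
    (hM : ∀ u : SimpleFunc T X, (∀ t, ‖u t - x₀‖ ≤ r) →
      ∃ k : T → ℝ, Integrable k μ ∧ (∀ᵐ t ∂μ, f t (u t) ≤ (k t : EReal)) ∧ ∫ t, k t ∂μ ≤ M)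
    {x : X} {φ : T → ℝ} (hφ : Integrable φ μ) (hfφ : ∀ᵐ t ∂μ, f t x = (φ t : EReal)) {ε : ℝ}
    {ξ : StrongDual ℝ X} (hξ : ξ ∈ epsSubdifferential ε (integralFun μ f) x) :
    ∃ (m : T → StrongDual ℝ X) (k : T → ℝ), Integrable k μ ∧ (∀ t, ‖m t‖ ≤ k t) ∧
      (∀ v, Measurable fun t => m t v) ∧
      (∀ w : SimpleFunc T X, Integrable (fun t => m t (w t)) μ) ∧
      ∀ (w : SimpleFunc T X) (z : X) (h₁ h₂ : T → ℝ), Integrable h₁ μ → Integrable h₂ μ →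
        (∀ᵐ t ∂μ, f t (x + w t) ≤ (h₁ t : EReal)) → (∀ᵐ t ∂μ, f t (x + z) ≤ (h₂ t : EReal)) →
        ∫ t, m t (w t) ∂μ + (ξ z - ∫ t, m t z ∂μ) ≤ ∫ t, h₁ t ∂μ - ∫ t, φ t ∂μ + ε := by
  obtain ⟨L, hLξ, hL⟩ := exists_extension_to_simpleFunc hconv hr hM hφ hfφ hξ
  have hLK : ∀ u : SimpleFunc T X, (∀ t, ‖u t‖ ≤ 1) →
      L u ≤ (M - ∫ t, φ t ∂μ + ε - ξ (x₀ - x)) / r := by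
    intro u hu
    obtain ⟨k, hk, hfk, hkM⟩ := hM (SimpleFunc.const T x₀ + r • u) (fun t => by
      simp only [SimpleFunc.coe_add, SimpleFunc.coe_smul, SimpleFunc.coe_const, Pi.add_apply,
        Pi.smul_apply, Function.const_apply, add_sub_cancel_left]
      rw [norm_smul, Real.norm_of_nonneg hr.le]
      exact mul_le_of_le_one_right hr.le (hu t))
    have h1 := hL (SimpleFunc.const T (x₀ - x) + r • u) k hk (by
      filter_upwards [hfk] with t ht
      convert ht using 2
      simp only [SimpleFunc.coe_add, SimpleFunc.coe_smul, SimpleFunc.coe_const, Pi.add_apply,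
        Pi.smul_apply, Function.const_apply]
      abel)
    rw [map_add, map_smul, hLξ, smul_eq_mul] at h1
    rw [le_div_iff₀ hr]
    linarith
  obtain ⟨F, N, hFm, hFmono, hFae, hLN, hNK, hNac⟩ := exists_absCont_part μ.toFinite hLK
  obtain ⟨m, k, hk, hmk, hmm, hmN⟩ :=
    hNac.exists_representation (toFinite_absolutelyContinuous μ) hNK
  refine ⟨m, k, hk, hmk, hmm, fun w => (hmN w).1, ?_⟩
  intro w z h₁ h₂ hh₁ hh₂ hf₁ hf₂
  have hFae' : ∀ᵐ t ∂μ, ∃ n, t ∈ F n := (absolutelyContinuous_toFinite μ).ae_le hFae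
  have hint : ∀ h : T → ℝ, Integrable h μ →
      Tendsto (fun n => ∫ t, (F n).indicator h t ∂μ) atTop (𝓝 (∫ t, h t ∂μ)) := by
    intro h hh
    have h1 := tendsto_setIntegral_of_monotone (μ := μ) (f := h) hFm hFmono hh.integrableOn
    have h2 : ∫ t in ⋃ n, F n, h t ∂μ = ∫ t, h t ∂μ := by
      rw [Measure.restrict_eq_self_of_ae_mem]
      filter_upwards [hFae'] with t ht using mem_iUnion.2 ht
    rw [h2] at h1
    simpa only [integral_indicator (hFm _)] using h1
  have hineq : ∀ n, L (w.restrict (F n)) +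
      (ξ z - L ((SimpleFunc.const T z).restrict (F n))) ≤
      ∫ t, (F n).indicator h₁ t ∂μ + (∫ t, h₂ t ∂μ - ∫ t, (F n).indicator h₂ t ∂μ) -
        ∫ t, φ t ∂μ + ε := by
    intro n
    have hi₁ := hh₁.indicator (hFm n)
    have hi₂ := hh₂.indicator (hFm n)
    have h1 := hL (w.restrict (F n) +
        (SimpleFunc.const T z - (SimpleFunc.const T z).restrict (F n)))
      (fun t => (F n).indicator h₁ t + (h₂ t - (F n).indicator h₂ t))
      (hi₁.add (hh₂.sub hi₂)) (by
        filter_upwards [hf₁, hf₂] with t h1 h2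
        simp only [SimpleFunc.coe_add, SimpleFunc.coe_sub, Pi.add_apply, Pi.sub_apply,
          SimpleFunc.restrict_apply _ (hFm n), SimpleFunc.coe_const, Function.const_apply]
        by_cases ht : t ∈ F n
        · simpa [ht] using h1
        · simpa [ht] using h2)
    have e1 : ∫ t, ((F n).indicator h₁ t + (h₂ t - (F n).indicator h₂ t)) ∂μ =
        ∫ t, (F n).indicator h₁ t ∂μ + (∫ t, h₂ t ∂μ - ∫ t, (F n).indicator h₂ t ∂μ) := by
      rw [integral_add (g := fun t => h₂ t - (F n).indicator h₂ t) hi₁ (hh₂.sub hi₂),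
        integral_sub hh₂ hi₂]
    rwa [map_add, map_sub, hLξ, e1] at h1
  have hlimL := (hLN w).add ((hLN (SimpleFunc.const T z)).const_sub (ξ z))
  have hlimR := (((hint h₁ hh₁).add ((hint h₂ hh₂).const_sub (∫ t, h₂ t ∂μ))).sub_const
    (∫ t, φ t ∂μ)).add_const ε
  have h := le_of_tendsto_of_tendsto' hlimL hlimR hineq
  rw [(hmN w).2, (hmN (SimpleFunc.const T z)).2] at h
  simpa using h

/-- Local boundedness of the integrand: if the integrals of `f t (u t)` are bounded for simple `u`
near `x₀`, almost every `f t` is bounded above on a fixed ball about `x₀`. -/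
lemma IsConvexNormalIntegrand.ae_bounded_on_ball [TopologicalSpace.SeparableSpace X]
    [MeasurableSpace X] {f : T → X → EReal} (hf : IsConvexNormalIntegrand μ f) {x₀ : X} {r M : ℝ}
    (hr : 0 < r)
    (hM : ∀ u : SimpleFunc T X, (∀ t, ‖u t - x₀‖ ≤ r) →
      ∃ k : T → ℝ, Integrable k μ ∧ (∀ᵐ t ∂μ, f t (u t) ≤ (k t : EReal)) ∧ ∫ t, k t ∂μ ≤ M)
    (hbot : ∀ y, integralFun μ f y ≠ ⊥) :
    ∀ᵐ t ∂μ, ∃ B : ℝ, ∀ y ∈ Metric.ball x₀ r, f t y ≤ (B : EReal) := by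
  classical
  let d := TopologicalSpace.denseSeq X
  let v : ℕ → X := fun i => if d i ∈ Metric.ball x₀ r then d i else x₀
  have hv : ∀ i, ‖v i - x₀‖ ≤ r := by
    intro i
    simp only [v]
    split_ifs with h
    · rw [← dist_eq_norm]
      exact (Metric.mem_ball.1 h).le
    · simpa using hr.le
  obtain ⟨k₀, hk₀, hfk₀, -⟩ := hM (SimpleFunc.const T (v 0)) fun t => hv 0
  obtain ⟨b, -, hb, hfb⟩ := exists_integrable_ae_eq_of_upperIntegral_ne
    (hf.measurable_section (v 0)) (hf.proper.mono fun t ht => ht.2 _)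
    ((upperIntegral_le hk₀ hfk₀).trans_lt (EReal.coe_lt_top _)).ne (hbot (v 0))
  obtain ⟨H, -, hH, -⟩ := exists_integrable_ge_of_forall_simpleFunc (μ := μ) (q := f)
    hf.measurable_section v hb (hfb.mono fun t ht => ht.ge) (singleton_nonempty M) (by
      rintro C rfl w hwv -
      refine hM w fun t => ?_
      obtain ⟨i, hi⟩ := hwv t
      rw [hi]
      exact hv i)
  filter_upwards [hH, hf.lsc] with t ht hlsc
  refine ⟨H t, fun y hy => ?_⟩
  have hcl : IsClosed {z | f t z ≤ (H t : EReal)} := hlsc.isClosed_preimage _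
  refine hcl.closure_subset_iff.2 ?_
    ((TopologicalSpace.denseRange_denseSeq X).open_subset_closure_inter Metric.isOpen_ball hy)
  rintro _ ⟨hz, i, rfl⟩
  have h1 := ht i
  simp only [v] at h1
  rwa [if_pos hz] at h1

/-- The nontrivial inclusion: an `ε`-subgradient of the integral function splits into the Gelfand
integral of a measurable selection of `ℓ t`-subgradients and an approximate normal to the domain.
The function `ℓ` is the pointwise defect in the Fenchel–Young inequality. -/
lemma exists_selection_add_normal [TopologicalSpace.SeparableSpace X] [MeasurableSpace X]
    {f : T → X → EReal} (hf : IsConvexNormalIntegrand μ f) {x₀ : X}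
    (hbdd : BoundedAboveNear (integralFunctional μ f) (constLinfty μ x₀))
    {x : X} {ε : ℝ} {ξ : StrongDual ℝ X} (hξ : ξ ∈ epsSubdifferential ε (integralFun μ f) x) :
    ∃ ε₁ ε₂ : ℝ, 0 ≤ ε₁ ∧ 0 ≤ ε₂ ∧ ε = ε₁ + ε₂ ∧ ∃ ℓ ∈ integrableBudget μ ε₁,
      ∃ (m : T → StrongDual ℝ X) (k : T → ℝ) (ξ₁ : StrongDual ℝ X), Integrable k μ ∧
        (∀ t, ‖m t‖ ≤ k t) ∧ (∀ v, Measurable fun t => m t v) ∧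
        (∀ᵐ t ∂μ, m t ∈ epsSubdifferential (ℓ t) (f t) x) ∧ IsGelfandIntegral μ m ξ₁ ∧
        ξ - ξ₁ ∈ epsNormalSet ε₂ (dom (integralFun μ f)) x := by
  classical
  obtain ⟨r, hr, M, hM⟩ := hbdd.exists_majorants
  -- the existence of a subgradient excludes the value `-∞` everywhere
  have hbot : ∀ y, integralFun μ f y ≠ ⊥ := by
    intro y hy
    have h1 := hξ.2.2 y
    rw [hy, EReal.bot_sub, EReal.bot_add] at h1
    exact absurd h1 (not_le.2 (EReal.bot_lt_coe _))
  have hpos : ∀ᵐ t ∂μ, ∀ y, ⊥ < f t y := hf.proper.mono fun t ht => ht.2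
  obtain ⟨φ, hφm, hφ, hfφ⟩ := exists_integrable_ae_eq_of_upperIntegral_ne
    (hf.measurable_section x) (hpos.mono fun t ht => ht x) hξ.1 hξ.2.1
  have hball := hf.ae_bounded_on_ball hr hM hbot
  obtain ⟨m, k, hk, hmk, hmm, hmi, hdec⟩ :=
    exists_decoupled_subgradient hf.convex hr hM hφ hfφ hξ
  have hmv : ∀ v, Integrable (fun t => m t v) μ := fun v => hmi (SimpleFunc.const T v)
  -- the Fenchel–Young defect at `x + v`
  let q : T → X → EReal := fun t v => ((m t v + φ t : ℝ) : EReal) + -f t (x + v)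
  have hqm : ∀ v, Measurable fun t => q t v := fun v =>
    ((hmm v).add hφm).coe_real_ereal.add
      (continuous_neg.measurable.comp (hf.measurable_section (x + v)))
  -- `v 0 = 0` makes the running maxima of `q`, and hence `ℓ`, nonnegative
  let v : ℕ → X := fun i => Nat.casesOn i 0 (TopologicalSpace.denseSeq X)
  have hq0 : ∀ᵐ t ∂μ, q t 0 = ((0 : ℝ) : EReal) := by
    filter_upwards [hfφ] with t ht
    simp only [q, add_zero, ht, map_zero, zero_add]
    norm_cast
    ring
  let S : Set ℝ := {C | ∃ z, x + z ∈ dom (integralFun μ f) ∧ C = ε - (ξ z - ∫ t, m t z ∂μ)}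
  have hxdom : x ∈ dom (integralFun μ f) := lt_top_iff_ne_top.2 hξ.1
  have hεS : ε ∈ S := ⟨0, by simpa using hxdom, by simp⟩
  obtain ⟨ℓ, hℓ, hqℓ, hℓS⟩ := exists_integrable_ge_of_forall_simpleFunc (μ := μ) hqm v
    (b := fun _ => 0) (integrable_zero _ _ _) (hq0.mono fun t ht => ht.ge) ⟨ε, hεS⟩ (by
      rintro _ ⟨z, hz, rfl⟩ w - hw
      obtain ⟨h₂, hh₂, hf₂, -⟩ := exists_integrable_of_upperIntegral_lt hz
      have hup : ∀ᵐ t ∂μ, f t (x + w t) ≤ ((m t (w t) + φ t : ℝ) : EReal) := by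
        filter_upwards [hq0, hpos] with t h1 h2
        have h3 : ((0 : ℝ) : EReal) ≤ q t (w t) := h1 ▸ hw t
        simp only [q] at h3
        have h4 := h2 (x + w t)
        revert h3 h4
        generalize f t (x + w t) = Y
        induction Y with
        | bot => simp
        | top => simp
        | coe y =>
          intro h3 _
          norm_cast at h3 ⊢
          linarith
      obtain ⟨ψ, -, hψ, hfψ⟩ := exists_integrable_ae_eq (hf.measurable_simpleFunc x w)
        (hpos.mono fun t ht => ht _) ((hmi w).add hφ) hup
        (c := ∫ t, m t (w t) ∂μ + (ξ z - ∫ t, m t z ∂μ) + ∫ t, φ t ∂μ - ε)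
        (fun h hh hfh => by
          have := hdec w z h h₂ hh hh₂ hfh hf₂
          linarith)
      refine ⟨fun t => m t (w t) + φ t - ψ t, ((hmi w).add hφ).sub hψ, ?_, ?_⟩
      · filter_upwards [hfψ] with t ht
        simp only [q, ht]
        norm_cast
      · have h1 := hdec w z ψ h₂ hψ hh₂ (hfψ.mono fun t ht => ht.le) hf₂
        rw [integral_sub (f := fun t => m t (w t) + φ t) ((hmi w).add hφ) hψ,
          integral_add (hmi w) hφ]
        linarith)
  have hℓ0 : ∀ᵐ t ∂μ, 0 ≤ ℓ t := by
    filter_upwards [hq0, hqℓ] with t h1 h2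
    have h3 := h2 0
    change q t 0 ≤ _ at h3
    rw [h1] at h3
    exact_mod_cast h3
  let ξ₁ : StrongDual ℝ X := LinearMap.mkContinuous
    { toFun := fun z => ∫ t, m t z ∂μ
      map_add' := fun a b => by
        simp only [map_add]
        exact integral_add (hmv a) (hmv b)
      map_smul' := fun a b => by
        simp only [map_smul, smul_eq_mul, RingHom.id_apply]
        exact integral_const_mul _ _ } (∫ t, k t ∂μ) (fun z => by
      rw [← integral_mul_const]
      exact norm_integral_le_of_norm_le (hk.mul_const _)
        (Eventually.of_forall fun t => (m t).le_of_opNorm_le (hmk t) z))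
  have hξ₁ : ∀ z, ξ₁ z = ∫ t, m t z ∂μ := fun z => rfl
  refine ⟨∫ t, ℓ t ∂μ, ε - ∫ t, ℓ t ∂μ, integral_nonneg_of_ae hℓ0, sub_nonneg.2 (hℓS ε hεS),
    by ring, ℓ, ⟨hℓ, hℓ0, le_rfl⟩, m, k, ξ₁, hk, hmk, hmm, ?_, ⟨hmv, hξ₁⟩, ?_⟩
  · filter_upwards [hfφ, hqℓ, hball, hf.convex, hpos] with t h1 h2 h3 h4 h5
    obtain ⟨B, hB⟩ := h3
    refine ⟨h1 ▸ EReal.coe_ne_top _, h1 ▸ EReal.coe_ne_bot _, fun y => ?_⟩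
    rw [h1, coe_le_sub_add_coe_iff]
    have hdense : Dense (range fun i => x + TopologicalSpace.denseSeq X i) :=
      (Homeomorph.addLeft x).surjective.denseRange.comp
        (TopologicalSpace.denseRange_denseSeq X) (Homeomorph.addLeft x).continuous
    have h6 := h4.affine_le_of_dense hr hB hdense (m t) (-m t x + φ t - ℓ t) (by
      rintro _ ⟨i, rfl⟩
      have h7 := h2 (i + 1)
      change ((m t (TopologicalSpace.denseSeq X i) + φ t : ℝ) : EReal) +
        -f t (x + TopologicalSpace.denseSeq X i) ≤ _ at h7
      have h8 := h5 (x + TopologicalSpace.denseSeq X i)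
      rw [map_add]
      revert h7 h8
      generalize f t (x + TopologicalSpace.denseSeq X i) = Y
      induction Y with
      | bot => simp
      | top => simp
      | coe y =>
        intro h7 _
        norm_cast at h7 ⊢
        linarith) y
    convert h6 using 2
    rw [map_sub]
    ring
  · have hind : indicatorFun (dom (integralFun μ f)) x = ((0 : ℝ) : EReal) := by
      rw [indicatorFun, if_pos hxdom]
      rfl
    refine ⟨hind ▸ EReal.coe_ne_top _, hind ▸ EReal.coe_ne_bot _, fun y => ?_⟩
    rw [hind, coe_le_sub_add_coe_iff, indicatorFun]
    split_ifs with hy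
    · have h1 := hℓS _ ⟨y - x, by simpa using hy, rfl⟩
      rw [← hξ₁] at h1
      have h2 : (ξ - ξ₁) (y - x) + 0 - (ε - ∫ t, ℓ t ∂μ) ≤ 0 := by
        change ξ (y - x) - ξ₁ (y - x) + 0 - _ ≤ 0
        linarith
      exact_mod_cast h2
    · exact le_top

/-- The elementary inclusion: integrate the pointwise inequalities and add the normal part. -/
lemma add_mem_epsSubdifferential_integralFun {f : T → X → EReal}
    [MeasurableSpace X] (hf : IsConvexNormalIntegrand μ f) {x : X}
    (hx : integralFun μ f x ≠ ⊥) {ε₁ ε₂ : ℝ} {ℓ : T → ℝ} (hℓ : ℓ ∈ integrableBudget μ ε₁)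
    {m : T → StrongDual ℝ X} (hm : ∀ᵐ t ∂μ, m t ∈ epsSubdifferential (ℓ t) (f t) x)
    {ξ₁ ξ₂ : StrongDual ℝ X} (h₁ : IsGelfandIntegral μ m ξ₁)
    (h₂ : ξ₂ ∈ epsNormalSet ε₂ (dom (integralFun μ f)) x) :
    ξ₁ + ξ₂ ∈ epsSubdifferential (ε₁ + ε₂) (integralFun μ f) x := by
  classical
  have hxdom : x ∈ dom (integralFun μ f) := by
    by_contra h
    exact h₂.1 (if_neg h)
  have hind : indicatorFun (dom (integralFun μ f)) x = ((0 : ℝ) : EReal) := by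
    rw [indicatorFun, if_pos hxdom]
    rfl
  obtain ⟨φ, -, hφ, hfφ⟩ := exists_integrable_ae_eq_of_upperIntegral_ne
    (hf.measurable_section x) (hf.proper.mono fun t ht => ht.2 x) hxdom.ne hx
  have hIx : integralFun μ f x = ((∫ t, φ t ∂μ : ℝ) : EReal) := upperIntegral_eq_integral hφ hfφ
  refine ⟨hxdom.ne, hx, fun y => ?_⟩
  rw [hIx, coe_le_sub_add_coe_iff]
  refine le_upperIntegral fun h hh hfh => ?_
  have hy : y ∈ dom (integralFun μ f) := (upperIntegral_le hh hfh).trans_lt (EReal.coe_lt_top _)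
  have e2 : ξ₂ (y - x) ≤ ε₂ := by
    have := h₂.2.2 y
    rw [hind, coe_le_sub_add_coe_iff, indicatorFun, if_pos hy] at this
    have h3 : ξ₂ (y - x) + 0 - ε₂ ≤ 0 := by exact_mod_cast this
    linarith
  have e1 : ξ₁ (y - x) ≤ ∫ t, (h t - φ t + ℓ t) ∂μ := by
    rw [h₁.2]
    refine integral_mono_ae (h₁.1 _) ((hh.sub hφ).add hℓ.1) ?_
    filter_upwards [hm, hfh, hfφ] with t h3 h4 h5
    have h6 := h3.2.2 y
    rw [h5, coe_le_sub_add_coe_iff] at h6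
    have h7 := EReal.coe_le_coe_iff.1 (h6.trans h4)
    linarith
  rw [integral_add (f := fun t => h t - φ t) (hh.sub hφ) hℓ.1, integral_sub hh hφ] at e1
  rw [EReal.coe_le_coe_iff]
  change ξ₁ (y - x) + ξ₂ (y - x) + _ - _ ≤ _
  have := hℓ.2.2
  linarith

end Functional

/-! ### Separability of duals and strong measurability -/

section Reflexive

/-- A normed space with separable dual is separable: vectors at which a dense sequence of
functionals nearly attain their norms span a dense subspace. -/
lemma separableSpace_of_separableSpace_dual (E : Type*) [NormedAddCommGroup E] [NormedSpace ℝ E]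
    [TopologicalSpace.SeparableSpace (StrongDual ℝ E)] : TopologicalSpace.SeparableSpace E := by
  let φ := TopologicalSpace.denseSeq (StrongDual ℝ E)
  have hex : ∀ n, ∃ y : E, ‖y‖ ≤ 1 ∧ ‖φ n‖ / 2 ≤ ‖φ n y‖ := by
    intro n
    rcases (norm_nonneg (φ n)).eq_or_lt with h | h
    · exact ⟨0, by simp, by simp [← h]⟩
    · obtain ⟨y, hy, hφy⟩ := (φ n).exists_lt_apply_of_lt_opNorm (half_lt_self h)
      exact ⟨y, hy.le, hφy.le⟩
  choose y hy hφy using hex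
  let V : Submodule ℝ E := (Submodule.span ℝ (range y)).topologicalClosure
  have hyV : ∀ n, y n ∈ V := fun n =>
    Submodule.le_topologicalClosure _ (Submodule.subset_span (mem_range_self n))
  have hV : V = ⊤ := by
    by_contra hne
    obtain ⟨x, -, hx⟩ := SetLike.exists_of_lt (lt_top_iff_ne_top.2 hne)
    obtain ⟨g, c, hgV, hgx⟩ := geometric_hahn_banach_closed_point V.convex
      (Submodule.isClosed_topologicalClosure _) hx
    have hg0 : ∀ v ∈ V, g v = 0 := by
      intro v hv
      by_contra h
      have h1 := hgV _ (V.smul_mem (c / g v) hv)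
      rw [map_smul, smul_eq_mul, div_mul_cancel₀ _ h] at h1
      exact lt_irrefl _ h1
    have hc : 0 < c := by simpa using hgV 0 V.zero_mem
    have hgle : ∀ δ > 0, ‖g‖ ≤ 3 * δ := by
      intro δ hδ
      obtain ⟨n, hn⟩ := (TopologicalSpace.denseRange_denseSeq (StrongDual ℝ E)).exists_dist_lt g hδ
      have h1 : ‖φ n (y n)‖ ≤ ‖φ n - g‖ := by
        have h2 := (φ n - g).le_of_opNorm_le_of_le le_rfl (hy n)
        rw [mul_one] at h2
        change ‖φ n (y n) - g (y n)‖ ≤ _ at h2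
        rwa [hg0 _ (hyV n), sub_zero] at h2
      rw [dist_comm, dist_eq_norm] at hn
      change ‖φ n - g‖ < δ at hn
      have h3 : ‖g‖ ≤ ‖φ n‖ + ‖φ n - g‖ := by
        have := norm_sub_le (φ n) (φ n - g)
        rwa [sub_sub_cancel] at this
      have h4 := hφy n
      linarith
    have h5 : ‖g‖ ≤ 0 := by
      refine le_of_forall_pos_le_add fun δ hδ => ?_
      have := hgle (δ / 3) (by positivity)
      linarith
    have h6 : g x = 0 := by
      rw [norm_le_zero_iff.1 h5]; rfl
    linarith
  have h1 : TopologicalSpace.IsSeparable (V : Set E) := by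
    rw [Submodule.topologicalClosure_coe]
    exact ((countable_range y).isSeparable.span (R := ℝ)).closure
  rw [hV, Submodule.top_coe] at h1
  exact TopologicalSpace.isSeparable_univ_iff.1 h1

variable {X : Type*} [NormedAddCommGroup X] [NormedSpace ℝ X]

lemma IsReflexive.separableSpace_dual [TopologicalSpace.SeparableSpace X] (h : IsReflexive X) :
    TopologicalSpace.SeparableSpace (StrongDual ℝ X) := by
  have : TopologicalSpace.SeparableSpace (StrongDual ℝ (StrongDual ℝ X)) :=
    h.denseRange.separableSpace (NormedSpace.inclusionInDoubleDual ℝ X).continuous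
  exact separableSpace_of_separableSpace_dual _

/-- Weak-star measurable functions into the dual of a separable space are strongly measurable if
the dual is separable, since the closed balls are countable intersections of weak-star
half-spaces. -/
lemma stronglyMeasurable_of_weakStar [TopologicalSpace.SeparableSpace X]
    [TopologicalSpace.SeparableSpace (StrongDual ℝ X)] {T : Type*} [MeasurableSpace T]
    {m : T → StrongDual ℝ X} (hm : ∀ v, Measurable fun t => m t v) : StronglyMeasurable m := by
  borelize (StrongDual ℝ X)
  have : SecondCountableTopology (StrongDual ℝ X) := UniformSpace.secondCountable_of_separable _
  let d := TopologicalSpace.denseSeq X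
  have hball : ∀ (η : StrongDual ℝ X) (c : ℝ), 0 ≤ c → MeasurableSet {t | ‖m t - η‖ ≤ c} := by
    intro η c hc
    have h1 : {t | ‖m t - η‖ ≤ c} = ⋂ i, {t | ‖m t (d i) - η (d i)‖ ≤ c * ‖d i‖} := by
      ext t
      simp only [mem_iInter]
      constructor
      · intro h i
        exact (m t - η).le_of_opNorm_le h (d i)
      · intro h
        refine (m t - η).opNorm_le_bound hc fun v => ?_
        refine (TopologicalSpace.denseRange_denseSeq X).induction_on
          (p := fun v => ‖(m t - η) v‖ ≤ c * ‖v‖) v ?_ h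
        exact isClosed_le (m t - η).continuous.norm (continuous_const.mul continuous_norm)
    rw [h1]
    exact MeasurableSet.iInter fun i => measurableSet_le ((hm _).sub_const _).norm measurable_const
  refine (measurable_of_isOpen fun U hU => ?_).stronglyMeasurable
  let e := TopologicalSpace.denseSeq (StrongDual ℝ X)
  let I : Set (ℕ × ℚ) := {p | 0 ≤ p.2 ∧ Metric.closedBall (e p.1) (p.2 : ℝ) ⊆ U}
  have h1 : m ⁻¹' U = ⋃ p ∈ I, {t | ‖m t - e p.1‖ ≤ (p.2 : ℝ)} := by
    ext t
    simp only [mem_preimage, mem_iUnion, exists_prop]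
    constructor
    · intro ht
      obtain ⟨ρ, hρ, hball⟩ := Metric.isOpen_iff.1 hU _ ht
      obtain ⟨i, hi⟩ := (TopologicalSpace.denseRange_denseSeq (StrongDual ℝ X)).exists_dist_lt
        (m t) (by positivity : 0 < ρ / 3)
      obtain ⟨c, hc1, hc2⟩ := exists_rat_btwn (by linarith : ρ / 3 < ρ / 2)
      have hc0 : (0 : ℝ) < c := lt_trans (by positivity) hc1
      refine ⟨(i, c), ⟨by exact_mod_cast hc0.le, fun η hη => hball ?_⟩, ?_⟩
      · rw [Metric.mem_closedBall] at hη
        rw [Metric.mem_ball]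
        have := dist_triangle η (e i) (m t)
        rw [dist_comm (e i)] at this
        change dist (m t) (e i) < _ at hi
        simp only at hη
        linarith
      · change ‖m t - e i‖ ≤ c
        rw [← dist_eq_norm]
        exact (hi.trans hc1).le
    · rintro ⟨p, hp, ht⟩
      exact hp.2 (by rwa [Metric.mem_closedBall, dist_eq_norm])
  rw [h1]
  exact MeasurableSet.biUnion (to_countable I) fun p hp => hball _ _ (by exact_mod_cast hp.1)

variable {T : Type*} [MeasurableSpace T] {μ : Measure T}

lemma memL1WeakStar_of_norm_le {m : T → StrongDual ℝ X} {k : T → ℝ} (hk : Integrable k μ)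
    (hmk : ∀ t, ‖m t‖ ≤ k t) (hm : IsWeakStarIntegrable μ m) : MemL1WeakStar μ m := by
  refine ⟨hm, fun B hB _ => ?_⟩
  obtain ⟨R, hR, hBR⟩ := hB.exists_pos_norm_le
  refine (upperIntegral_le (hk.mul_const R) (Eventually.of_forall fun t => ?_)).trans_lt
    (EReal.coe_lt_top _)
  refine iSup₂_le fun v hv => EReal.coe_le_coe_iff.2 ?_
  exact (le_abs_self _).trans ((m t).le_of_opNorm_le_of_le (hmk t) (hBR v hv))

lemma isGelfandIntegral_integral [CompleteSpace X] {m : T → StrongDual ℝ X}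
    (hm : Integrable m μ) : IsGelfandIntegral μ m (∫ t, m t ∂μ) :=
  ⟨fun v => hm.apply_continuousLinearMap v, fun v => ContinuousLinearMap.integral_apply hm v⟩

end Reflexive

end ConvexIntegral

theorem mainTheorem3
    {T : Type*} [MeasurableSpace T] (μ : Measure T) [SigmaFinite μ] [μ.IsComplete]
    {X : Type*} [NormedAddCommGroup X] [NormedSpace ℝ X] [CompleteSpace X]
    [TopologicalSpace.SeparableSpace X] [MeasurableSpace X] [BorelSpace X]
    (f : T → X → EReal) (hf : ConvexIntegral.IsConvexNormalIntegrand μ f)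
    (x₀ : X)
    (hbdd : ConvexIntegral.BoundedAboveNear (ConvexIntegral.integralFunctional μ f)
      (ConvexIntegral.constLinfty μ x₀))
    (x : X) (hx : ConvexIntegral.integralFun μ f x ≠ ⊥)
    (ε : ℝ) (hε : 0 ≤ ε) :
    ConvexIntegral.epsSubdifferential ε (ConvexIntegral.integralFun μ f) x =
        {ξ | ∃ ε₁ ε₂ : ℝ, 0 ≤ ε₁ ∧ 0 ≤ ε₂ ∧ ε = ε₁ + ε₂ ∧
          ∃ ℓ ∈ ConvexIntegral.integrableBudget μ ε₁,
            ξ ∈ ConvexIntegral.gelfandAumannIntegral μ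
                  (fun t => ConvexIntegral.epsSubdifferential (ℓ t) (f t) x) +
                ConvexIntegral.epsNormalSet ε₂
                  (ConvexIntegral.dom (ConvexIntegral.integralFun μ f)) x} ∧
      (ConvexIntegral.IsReflexive X →
        ConvexIntegral.epsSubdifferential ε (ConvexIntegral.integralFun μ f) x =
          {ξ | ∃ ε₁ ε₂ : ℝ, 0 ≤ ε₁ ∧ 0 ≤ ε₂ ∧ ε = ε₁ + ε₂ ∧
            ∃ ℓ ∈ ConvexIntegral.integrableBudget μ ε₁,
              ξ ∈ ConvexIntegral.strongAumannIntegral μ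
                    (fun t => ConvexIntegral.epsSubdifferential (ℓ t) (f t) x) +
                  ConvexIntegral.epsNormalSet ε₂
                    (ConvexIntegral.dom (ConvexIntegral.integralFun μ f)) x}) := by
  open ConvexIntegral in
  refine ⟨Subset.antisymm ?_ ?_, fun hrefl => Subset.antisymm ?_ ?_⟩
  · intro ξ hξ
    obtain ⟨ε₁, ε₂, h₁, h₂, h₃, ℓ, hℓ, m, k, ξ₁, hk, hmk, -, hm, hξ₁, hN⟩ :=
      exists_selection_add_normal hf hbdd hξ
    exact ⟨ε₁, ε₂, h₁, h₂, h₃, ℓ, hℓ, Set.mem_add.2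
      ⟨ξ₁, ⟨m, memL1WeakStar_of_norm_le hk hmk hξ₁.1, hm, hξ₁⟩, _, hN, add_sub_cancel _ _⟩⟩
  · rintro ξ ⟨ε₁, ε₂, -, -, rfl, ℓ, hℓ, hmem⟩
    obtain ⟨ξ₁, ⟨m, -, hm, hξ₁⟩, ξ₂, hξ₂, rfl⟩ := Set.mem_add.1 hmem
    exact add_mem_epsSubdifferential_integralFun hf hx hℓ hm hξ₁ hξ₂
  · intro ξ hξ
    obtain ⟨ε₁, ε₂, h₁, h₂, h₃, ℓ, hℓ, m, k, ξ₁, hk, hmk, hmm, hm, hξ₁, hN⟩ :=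
      exists_selection_add_normal hf hbdd hξ
    have := hrefl.separableSpace_dual
    have hmi : Integrable m μ := hk.mono' (stronglyMeasurable_of_weakStar hmm).aestronglyMeasurable
      (Filter.Eventually.of_forall hmk)
    have hξ₁' : ξ₁ = ∫ t, m t ∂μ := by
      ext v
      rw [hξ₁.2, (isGelfandIntegral_integral hmi).2]
    exact ⟨ε₁, ε₂, h₁, h₂, h₃, ℓ, hℓ, Set.mem_add.2
      ⟨ξ₁, ⟨m, hmi, hm, hξ₁'⟩, _, hN, add_sub_cancel _ _⟩⟩
  · rintro ξ ⟨ε₁, ε₂, -, -, rfl, ℓ, hℓ, hmem⟩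
    obtain ⟨ξ₁, ⟨m, hmi, hm, rfl⟩, ξ₂, hξ₂, rfl⟩ := Set.mem_add.1 hmem
    exact add_mem_epsSubdifferential_integralFun hf hx hℓ hm (isGelfandIntegral_integral hmi) hξ₂
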